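/- **Notation.** Let $q$ be a complex number with $|q|<1$. For $a,p\in\mathbb C$ and $n\ge 0$ put $(a;p)_n=\prod_{i=0}^{n-1}(1-ap^i)$ and $(a_1,\dots,a_j;p)_n=(a_1;p)_n\cdots(a_j;p)_n$. Let $\psi(q)=\sum_{n=0}^{\infty}q^{n(n+1)/2}$ be Ramanujan's theta function. A pair of sequences $(\alpha_n,\beta_n)_{n\ge0}$ is a *Bailey pair with respect to $a$ with base $p$* if $\alpha_0=\beta_0=1$ and, for $n>0$, $$\beta_n=\sum_{j=0}^{n}\frac{\alpha_j}{(p;p)_{n-j}(ap;p)_{n+j}} .$$ An infinite series is understood as the limit of its partial sums; that all series below converge (in (iii): that the two $\beta$-series converge) is part of the assertion. **Corollary.** (i) $$q\frac{\psi^3(q^3)}{\psi(q)}=\sum_{n=1}^{\infty}\frac{(1-q^{6n-2})(-q^3;q^3)_{n-1}q^{(3n^2-n)/2}}{(1-q^{3n-2})(1-q^{3n})(-q;q^3)_n}-\sum_{n=1}^{\infty}\frac{(1-q^{6n-1})(-q^3;q^3)_{n-1}q^{(3n^2+n)/2}}{(1-q^{3n-1})(1-q^{3n})(-q^2;q^3)_n}.$$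 (ii) $$q\frac{\psi^3(q^3)}{\psi(q)}=\sum_{n=1}^{\infty}\frac{(-q^3;q^3)_{n-1}(-1)^nq^{2n}}{(1-q^{3n})(q^2;q^3)_n}-\sum_{n=1}^{\infty}\frac{(-q^3;q^3)_{n-1}(-1)^nq^{n}}{(1-q^{3n})(q;q^3)_n}.$$ Suppose from now on that $q\neq0$. (iii) Let $\alpha_n(a,p),\beta_n(a,p)$ be families of sequences, depending on a free parameter $a$ and on the base $p$, such that $(\alpha_n(a,p),\beta_n(a,p))$ is a Bailey pair with respect to $a$ with base $p$ for $(a,p)=(1/q,q^3)$ and for $(a,p)=(1/q^2,q^3)$. If the two series below that contain $\alpha_n$ converge, then so do the two that contain $\beta_n$, and $$q\frac{\psi^3(q^3)}{\psi(q)}=\sum_{n=1}^{\infty}(q^6;q^6)_{n-1}(-q^2)^n\beta_n(1/q,q^3)-\sum_{n=1}^{\infty}(q^6;q^6)_{n-1}(-q)^n\beta_n(1/q^2,q^3)$$ $$\qquad+\sum_{n=1}^{\infty}\frac{(q^6;q^6)_{n-1}(-q)^n}{(q^2;q^6)_n}\alpha_n(1/q^2,q^3)-\sum_{n=1}^{\infty}\frac{(q^6;q^6)_{n-1}(-q^2)^n}{(q^4;q^6)_n}\alpha_n(1/q,q^3).$$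 (iv) Let $d\in\mathbb C$, $d\neq0$, with $d\neq q^{3n+1}$ and $d\neq q^{3n+2}$ for all integers $n\ge0$. Then $$q\frac{\psi^3(q^3)}{\psi(q)}=\sum_{n=1}^{\infty}\frac{(q^6;q^6)_{n-1}(q^2/d;q^6)_n(-q^2)^n}{(q^2;q^6)_n(q^2/d,q^3;q^3)_n}-\sum_{n=1}^{\infty}\frac{(q^6;q^6)_{n-1}(q/d;q^6)_n(-q)^n}{(q;q^6)_n(q/d,q^3;q^3)_n}$$ $$\qquad+\sum_{n=1}^{\infty}\frac{(1-q^{12n-2})(q^6;q^6)_{2n-1}(1/q^2,d;q^6)_nq^{6n^2}}{(1-1/q^2)(q^2;q^6)_{2n}(q^4/d,q^6;q^6)_nd^n}-\sum_{n=1}^{\infty}\frac{(1-q^{12n-1})(q^6;q^6)_{2n-1}(1/q,d;q^6)_nq^{6n^2+3n}}{(1-1/q)(q^4;q^6)_{2n}(q^5/d,q^6;q^6)_nd^n}.$$ (v) $$q\frac{\psi^3(q^3)}{\psi(q)}=\sum_{n=1}^{\infty}\frac{(q^6;q^6)_{n-1}(-q^2)^n}{(q^2;q^6)_n(q^3;q^3)_n}-\sum_{n=1}^{\infty}\frac{(q^6;q^6)_{n-1}(-q)^n}{(q;q^6)_n(q^3;q^3)_n}$$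 $$\qquad+\sum_{n=1}^{\infty}\frac{(1-q^{12n-2})(q^6;q^6)_{2n-1}(1/q^2;q^6)_n(-1)^nq^{9n^2-3n}}{(1-1/q^2)(q^2;q^6)_{2n}(q^6;q^6)_n}-\sum_{n=1}^{\infty}\frac{(1-q^{12n-1})(q^6;q^6)_{2n-1}(1/q;q^6)_n(-1)^nq^{9n^2}}{(1-1/q)(q^4;q^6)_{2n}(q^6;q^6)_n}.$$ -/

import Mathlib

open Filter Topology

/-- The finite `q`-shifted factorial `(a; q)_n = (1 - a) (1 - a q) ⋯ (1 - a q ^ (n - 1))`. -/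
noncomputable def qPoch (a q : ℂ) (n : ℕ) : ℂ :=
  ∏ i ∈ Finset.range n, (1 - a * q ^ i)

/-- Ramanujan's theta function `ψ(q) = ∑_{n ≥ 0} q ^ (n (n + 1) / 2)`. -/
noncomputable def ramanujanPsi (q : ℂ) : ℂ :=
  ∑' n : ℕ, q ^ (n * (n + 1) / 2)

/-- `(α_n, β_n)` is a Bailey pair with respect to `a`, with base `q`. -/
structure IsBaileyPair (a q : ℂ) (α β : ℕ → ℂ) : Prop where
  alpha_zero : α 0 = 1
  beta_zero : β 0 = 1
  beta_eq : ∀ n : ℕ, 0 < n → β n =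
    ∑ j ∈ Finset.range (n + 1), α j / (qPoch q q (n - j) * qPoch (a * q) q (n + j))

/-- The series `∑_{n ≥ 1} u n` converges, with sum `s`: its partial sums
`u 1 + ⋯ + u N` tend to `s`. -/
def SeriesSum (u : ℕ → ℂ) (s : ℂ) : Prop :=
  Tendsto (fun N : ℕ => ∑ n ∈ Finset.Icc 1 N, u n) atTop (𝓝 s)

/-! All five expansions rest on one function. With base p put L(c) = ∑_{n≥1} (-p;p)_{n-1} (-c)^n /
((1-p^n) (c;p)_n), the sum of `lambertTerm p c`. Creative telescoping gives L(c) = -c/(1-c²) +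
L(cp), and iteration gives L(c) = -∑_k c p^k/(1-c² p^{2k}). The series with quadratic exponents
satisfies the same equation with the sign reversed, so its sum is -L(c). Hence (i) and (ii) both say
that, for p = q³, the left side is L(q²) - L(q), a difference of two Lambert series.

That identity (`lambertTerm_sub_eq_theta`) comes from Gauss's product for ψ and a finite partial
fraction expansion. With x = q³, expand ∏_{l<2N} (b - x^{2l-1})/(b - x^{2l}) at b = q^{6N-2}. The
nodes above and below b give the two Lambert series, with weights tending to 1/ψ(q³)². The product
itself gives the quotient ψ(q³)/ψ(q).

For (iii), substitute the definition of β_n into its series and exchange sums. By a q-Gauss sum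
(`tsum_gaussTerm`) each α_j with j ≥ 1 receives its stated coefficient, while j = 0 contributes
exactly L(c), where c = ap. The choices a = 1/q and a = 1/q² give c = q² and c = q. Since the
α-series need only converge conditionally, the exchange is made on partial sums, as a regular
summation method (`tendsto_sum_convolution`).

For (iv) and (v), apply this to a Bailey pair whose α is supported on even indices
(`isBaileyPair_evenAlpha`), proved by a WZ-style certificate. The parameter is e = 1/d, with
(d;p²)_j/d^j written as ∏ (e - p^{2i}). Thus (v) is the legitimate value e = 0 and needs no limit d
→ ∞. -/

/-! ### Shifted factorials: identities and uniform bounds. -/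

theorem qPoch_succ (a q : ℂ) (n : ℕ) :
    qPoch a q (n + 1) = qPoch a q n * (1 - a * q ^ n) := by
  simp [qPoch, Finset.prod_range_succ]

theorem qPoch_add (a q : ℂ) (m n : ℕ) :
    qPoch a q (m + n) = qPoch a q m * qPoch (a * q ^ m) q n := by
  simp only [qPoch, Finset.prod_range_add]
  congr 1
  exact Finset.prod_congr rfl fun i _ => by ring

theorem qPoch_succ' (a q : ℂ) (n : ℕ) :
    qPoch a q (n + 1) = (1 - a) * qPoch (a * q) q n := by
  rw [add_comm, qPoch_add]
  simp [qPoch]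

theorem qPoch_mul_neg (a q : ℂ) (n : ℕ) :
    qPoch a q n * qPoch (-a) q n = qPoch (a ^ 2) (q ^ 2) n := by
  simp only [qPoch, ← Finset.prod_mul_distrib]
  exact Finset.prod_congr rfl fun i _ => by ring

theorem one_sub_ne_zero_of_norm {x : ℂ} (h : ‖x‖ < 1) : 1 - x ≠ 0 := by
  intro h0
  rw [← sub_eq_zero.mp h0] at h
  simp at h

theorem one_add_ne_zero_of_norm {x : ℂ} (h : ‖x‖ < 1) : 1 + x ≠ 0 := by
  simpa using one_sub_ne_zero_of_norm (x := -x) (by simpa using h)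

theorem norm_mul_pow_le {a q : ℂ} (hq : ‖q‖ ≤ 1) (n : ℕ) : ‖a * q ^ n‖ ≤ ‖a‖ := by
  rw [norm_mul, norm_pow]
  exact mul_le_of_le_one_right (norm_nonneg a) (pow_le_one₀ (norm_nonneg q) hq)

theorem norm_mul_pow_lt {a q : ℂ} (ha : ‖a‖ < 1) (hq : ‖q‖ ≤ 1) (n : ℕ) : ‖a * q ^ n‖ < 1 :=
  (norm_mul_pow_le hq n).trans_lt ha

theorem norm_pow_succ_lt {q : ℂ} (hq : ‖q‖ < 1) (n : ℕ) : ‖q ^ (n + 1)‖ < 1 := by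
  rw [pow_succ']
  exact norm_mul_pow_lt hq hq.le n

theorem qPoch_ne_zero {a q : ℂ} (h : ∀ k : ℕ, a * q ^ k ≠ 1) (n : ℕ) : qPoch a q n ≠ 0 :=
  Finset.prod_ne_zero_iff.mpr fun i _ => sub_ne_zero.mpr (h i).symm

theorem qPoch_ne_zero_of_norm {a q : ℂ} (ha : ‖a‖ < 1) (hq : ‖q‖ ≤ 1) (n : ℕ) :
    qPoch a q n ≠ 0 :=
  Finset.prod_ne_zero_iff.mpr fun i _ => one_sub_ne_zero_of_norm (norm_mul_pow_lt ha hq i)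

theorem prod_one_add_pow_le {r s : ℝ} (hs : 0 ≤ s) (hr : 0 ≤ r) (hr1 : r < 1) (n : ℕ) :
    ∏ i ∈ Finset.range n, (1 + s * r ^ i) ≤ Real.exp (s / (1 - r)) := by
  calc ∏ i ∈ Finset.range n, (1 + s * r ^ i)
      ≤ ∏ i ∈ Finset.range n, Real.exp (s * r ^ i) := by
        refine Finset.prod_le_prod (fun i _ => by positivity) fun i _ => ?_
        rw [add_comm]
        exact Real.add_one_le_exp _
    _ = Real.exp (s * ∑ i ∈ Finset.range n, r ^ i) := by
        rw [← Real.exp_sum, Finset.mul_sum]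
    _ ≤ _ := by
        rw [div_eq_mul_inv, ← tsum_geometric_of_lt_one hr hr1]
        gcongr
        exact (summable_geometric_of_lt_one hr hr1).sum_le_tsum _ fun i _ => by positivity

theorem norm_qPoch_le {a q : ℂ} {s : ℝ} (ha : ‖a‖ ≤ s) (hq : ‖q‖ < 1) (n : ℕ) :
    ‖qPoch a q n‖ ≤ Real.exp (s / (1 - ‖q‖)) := by
  refine le_trans ?_ (prod_one_add_pow_le ((norm_nonneg a).trans ha) (norm_nonneg q) hq n)
  rw [qPoch, norm_prod]
  refine Finset.prod_le_prod (fun i _ => norm_nonneg _) fun i _ => ?_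
  refine (norm_sub_le _ _).trans ?_
  rw [norm_one, norm_mul, norm_pow]
  gcongr

/-- Each factor satisfies 1/|1-z| ≤ 1 + |q|^i s/(1-s), because |1-z| is at least both 1-s and 1-|z|.
The bound depends on `a` only through `s`; this uniformity is what permits limits along c p^k. -/
theorem norm_inv_qPoch_le {a q : ℂ} {s : ℝ} (ha : ‖a‖ ≤ s) (hs : s < 1) (hq : ‖q‖ < 1) (n : ℕ) :
    ‖(qPoch a q n)⁻¹‖ ≤ Real.exp (s / (1 - s) / (1 - ‖q‖)) := by
  have hs0 : 0 ≤ s := (norm_nonneg a).trans ha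
  have hs1 : 0 < 1 - s := by linarith
  refine le_trans ?_ (prod_one_add_pow_le (s := s / (1 - s)) (by positivity) (norm_nonneg q) hq n)
  rw [qPoch, ← Finset.prod_inv_distrib, norm_prod]
  refine Finset.prod_le_prod (fun i _ => norm_nonneg _) fun i _ => ?_
  have h1 : ‖a * q ^ i‖ ≤ s * ‖q‖ ^ i := by
    rw [norm_mul, norm_pow]
    gcongr
  have hle : ‖a * q ^ i‖ ≤ s := (norm_mul_pow_le hq.le i).trans ha
  have h2 : 1 - s ≤ ‖1 - a * q ^ i‖ := by
    have := norm_sub_norm_le (1 : ℂ) (a * q ^ i)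
    rw [norm_one] at this
    linarith
  have h3 : 1 - ‖a * q ^ i‖ ≤ ‖1 - a * q ^ i‖ := by
    have := norm_sub_norm_le (1 : ℂ) (a * q ^ i)
    rwa [norm_one] at this
  rw [norm_inv]
  have h4 : 0 < ‖1 - a * q ^ i‖ := hs1.trans_le h2
  rw [inv_le_iff_one_le_mul₀ h4]
  have h5 : s * ‖q‖ ^ i ≤ s / (1 - s) * ‖q‖ ^ i * ‖1 - a * q ^ i‖ := by
    calc s * ‖q‖ ^ i = s / (1 - s) * ‖q‖ ^ i * (1 - s) := by field_simp
      _ ≤ _ := by gcongr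
  nlinarith

/-- Split off finitely many factors until |a q^k| < 1. A vanishing factor does no harm, since the
inverse of zero is zero. -/
theorem exists_norm_inv_qPoch_le (a : ℂ) {q : ℂ} (hq : ‖q‖ < 1) :
    ∃ C : ℝ, 0 < C ∧ ∀ n : ℕ, ‖(qPoch a q n)⁻¹‖ ≤ C := by
  have ht : Tendsto (fun k : ℕ => ‖a * q ^ k‖) atTop (𝓝 0) := by
    have := (tendsto_pow_atTop_nhds_zero_of_norm_lt_one hq).const_mul a
    simpa using this.norm
  obtain ⟨k, hk⟩ := (ht.eventually_lt_const (show (0 : ℝ) < 1 by norm_num)).exists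
  set B := Real.exp (‖a * q ^ k‖ / (1 - ‖a * q ^ k‖) / (1 - ‖q‖)) with hB
  set S := ∑ i ∈ Finset.range k, ‖(qPoch a q i)⁻¹‖ with hS
  have hS0 : 0 ≤ S := Finset.sum_nonneg fun i _ => norm_nonneg _
  refine ⟨S + ‖(qPoch a q k)⁻¹‖ * B + 1, by positivity, fun n => ?_⟩
  rcases lt_or_ge n k with h | h
  · have h1 : ‖(qPoch a q n)⁻¹‖ ≤ S :=
      Finset.single_le_sum (f := fun i => ‖(qPoch a q i)⁻¹‖) (fun i _ => norm_nonneg _)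
        (Finset.mem_range.mpr h)
    have : 0 ≤ ‖(qPoch a q k)⁻¹‖ * B := by positivity
    linarith
  · obtain ⟨m, rfl⟩ := Nat.exists_eq_add_of_le h
    rw [qPoch_add, mul_inv, norm_mul]
    have h1 := norm_inv_qPoch_le (le_refl ‖a * q ^ k‖) hk hq m
    have : ‖(qPoch a q k)⁻¹‖ * ‖(qPoch (a * q ^ k) q m)⁻¹‖ ≤ ‖(qPoch a q k)⁻¹‖ * B := by gcongr
    linarith

/-! ### Series, telescoping and functional equations. -/

theorem seriesSum_iff {u : ℕ → ℂ} {s : ℂ} :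
    SeriesSum u s ↔ Tendsto (fun N : ℕ => ∑ n ∈ Finset.range N, u (n + 1)) atTop (𝓝 s) := by
  have : ∀ N : ℕ, ∑ n ∈ Finset.Icc 1 N, u n = ∑ n ∈ Finset.range N, u (n + 1) := fun N => by
    rw [Finset.range_eq_Ico, Finset.sum_Ico_add' u 0 N 1]
    rfl
  simp only [SeriesSum, this]

theorem SeriesSum.congr {u v : ℕ → ℂ} {s : ℂ} (h : SeriesSum u s)
    (huv : ∀ n, v (n + 1) = u (n + 1)) : SeriesSum v s := by
  rw [seriesSum_iff] at h ⊢
  simpa only [huv] using h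

theorem HasSum.seriesSum {u : ℕ → ℂ} {s : ℂ} (h : HasSum (fun n => u (n + 1)) s) :
    SeriesSum u s :=
  seriesSum_iff.mpr h.tendsto_sum_nat

/-- If the terms of a power-like series are dominated by `C * ‖c‖ ^ (n + 1)`, the series is
summable. -/
theorem summable_of_norm_le_pow {t : ℕ → ℂ} {C r : ℝ} (hr : 0 ≤ r) (hr1 : r < 1)
    (h : ∀ n, ‖t n‖ ≤ C * r ^ (n + 1)) : Summable t := by
  refine Summable.of_norm_bounded (g := fun n => C * r ^ (n + 1)) ?_ h
  exact ((summable_nat_add_iff 1).mpr (summable_geometric_of_lt_one hr hr1)).mul_left C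

/-- Of the n+1 factors |x|, with x = c p^k, one supplies the decay |p|^k and the other n the
summable majorant |c|^n. -/
theorem tendsto_tsum_mul_pow_zero {t : ℂ → ℕ → ℂ} {C : ℝ} {c p : ℂ} (hc : ‖c‖ < 1) (hp : ‖p‖ < 1)
    (h : ∀ x n, ‖x‖ ≤ ‖c‖ → ‖t x n‖ ≤ C * ‖x‖ ^ (n + 1)) :
    Tendsto (fun k : ℕ => ∑' n, t (c * p ^ k) n) atTop (𝓝 0) := by
  have hsum : Summable fun n : ℕ => |C| * ‖c‖ ^ n :=
    (summable_geometric_of_lt_one (norm_nonneg c) hc).mul_left _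
  have hb : ∀ k : ℕ, ‖∑' n, t (c * p ^ k) n‖ ≤ (∑' n : ℕ, |C| * ‖c‖ ^ n) * ‖p‖ ^ k := by
    intro k
    rw [← tsum_mul_right]
    refine tsum_of_norm_bounded (hsum.mul_right _).hasSum fun n => ?_
    refine (h _ n (norm_mul_pow_le hp.le k)).trans ?_
    have h1 : ‖c * p ^ k‖ ≤ ‖p‖ ^ k := by
      rw [norm_mul, norm_pow]
      exact mul_le_of_le_one_left (by positivity) hc.le
    have h2 := norm_mul_pow_le (a := c) hp.le k
    calc C * ‖c * p ^ k‖ ^ (n + 1) ≤ |C| * (‖c * p ^ k‖ ^ n * ‖c * p ^ k‖) := by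
          rw [pow_succ]
          gcongr
          exact le_abs_self C
      _ ≤ |C| * (‖c‖ ^ n * ‖p‖ ^ k) := by gcongr
      _ = _ := by ring
  refine squeeze_zero_norm hb ?_
  simpa using (tendsto_pow_atTop_nhds_zero_of_lt_one (norm_nonneg p) hp).const_mul
    (∑' n : ℕ, |C| * ‖c‖ ^ n)

/-- Iteration of the functional equation `f c = g c + f (c p)`. -/
theorem tendsto_sum_of_functional_eq {f g : ℂ → ℂ} {c p : ℂ}
    (h : ∀ k : ℕ, f (c * p ^ k) = g (c * p ^ k) + f (c * p ^ (k + 1)))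
    (h0 : Tendsto (fun k : ℕ => f (c * p ^ k)) atTop (𝓝 0)) :
    Tendsto (fun K : ℕ => ∑ k ∈ Finset.range K, g (c * p ^ k)) atTop (𝓝 (f c)) := by
  have : ∀ K : ℕ, ∑ k ∈ Finset.range K, g (c * p ^ k) = f c - f (c * p ^ K) := by
    intro K
    induction K with
    | zero => simp
    | succ K ih => rw [Finset.sum_range_succ, ih, h K]; ring
  simp only [this]
  simpa using h0.const_sub (f c)

/-- Creative telescoping: the certificate `U` turns a termwise relation between a series at c and
the one at cp into a functional equation for the sums. -/
theorem tsum_eq_of_telescope {t s U : ℕ → ℂ} (ht : Summable t) (hs : Summable s)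
    (h : ∀ n, t n = s n + (U n - U (n + 1))) (hU : Tendsto U atTop (𝓝 0)) :
    ∑' n, t n = U 0 + ∑' n, s n := by
  have h1 : Tendsto (fun N : ℕ => ∑ n ∈ Finset.range N, (t n - s n)) atTop (𝓝 (U 0)) := by
    have : ∀ N : ℕ, ∑ n ∈ Finset.range N, (t n - s n) = U 0 - U N := fun N => by
      rw [← Finset.sum_range_sub']
      exact Finset.sum_congr rfl fun n _ => by rw [h n]; ring
    simp only [this]
    simpa using hU.const_sub (U 0)
  have h2 := tendsto_nhds_unique h1 (ht.sub hs).hasSum.tendsto_sum_nat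
  rw [ht.tsum_sub hs] at h2
  rw [h2]
  ring

theorem tendsto_zero_of_norm_le_pow {t : ℕ → ℂ} {C r : ℝ} (hr : 0 ≤ r) (hr1 : r < 1)
    (h : ∀ n, ‖t n‖ ≤ C * r ^ (n + 1)) : Tendsto t atTop (𝓝 0) :=
  (summable_of_norm_le_pow hr hr1 h).tendsto_atTop_zero

theorem norm_inv_one_sub_pow_le {p : ℂ} (hp : ‖p‖ < 1) (n : ℕ) :
    ‖(1 - p ^ (n + 1))⁻¹‖ ≤ (1 - ‖p‖)⁻¹ := by
  have h1 := norm_sub_norm_le (1 : ℂ) (p ^ (n + 1))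
  have h2 : ‖p ^ (n + 1)‖ ≤ ‖p‖ := by
    rw [pow_succ']
    exact norm_mul_pow_le hp.le n
  rw [norm_one] at h1
  rw [norm_inv]
  exact inv_anti₀ (by linarith) (by linarith)

theorem norm_inv_one_sub_le {x : ℂ} {r : ℝ} (hx : ‖x‖ ≤ r) (hr : r < 1) :
    ‖(1 - x)⁻¹‖ ≤ (1 - r)⁻¹ := by
  have h1 := norm_sub_norm_le (1 : ℂ) x
  rw [norm_one] at h1
  rw [norm_inv]
  exact inv_anti₀ (by linarith) (by linarith)

/-! ### The two series representations of the Lambert series. -/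

/-- The general term (shifted by one) of
`∑_{n ≥ 1} (-p; p)_{n-1} (-c)^n / ((1 - p^n) (c; p)_n)`. -/
noncomputable def lambertTerm (p c : ℂ) (n : ℕ) : ℂ :=
  qPoch (-p) p n * (-c) ^ (n + 1) / ((1 - p ^ (n + 1)) * qPoch c p (n + 1))

theorem exists_norm_lambertTerm_le {p : ℂ} {r : ℝ} (hp : ‖p‖ < 1) (hr1 : r < 1) :
    ∃ C : ℝ, ∀ (x : ℂ) (n : ℕ), ‖x‖ ≤ r → ‖lambertTerm p x n‖ ≤ C * ‖x‖ ^ (n + 1) := by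
  refine ⟨Real.exp (1 / (1 - ‖p‖)) * (1 - ‖p‖)⁻¹ * Real.exp (r / (1 - r) / (1 - ‖p‖)),
    fun x n hx => ?_⟩
  have h1 := norm_qPoch_le (a := -p) (s := 1) (by simpa using hp.le) hp n
  have h2 := norm_inv_one_sub_pow_le hp n
  have h3 := norm_inv_qPoch_le hx hr1 hp (n + 1)
  have h0 : 0 < 1 - ‖p‖ := by linarith
  rw [lambertTerm, div_eq_mul_inv, mul_inv, norm_mul, norm_mul, norm_mul, norm_pow, norm_neg]
  calc _ ≤ Real.exp (1 / (1 - ‖p‖)) * ‖x‖ ^ (n + 1) *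
        ((1 - ‖p‖)⁻¹ * Real.exp (r / (1 - r) / (1 - ‖p‖))) := by gcongr
    _ = _ := by ring

theorem summable_lambertTerm {p c : ℂ} (hp : ‖p‖ < 1) (hc : ‖c‖ < 1) :
    Summable (lambertTerm p c) := by
  obtain ⟨C, hC⟩ := exists_norm_lambertTerm_le hp hc
  exact summable_of_norm_le_pow (norm_nonneg c) hc fun n => hC c n le_rfl

theorem tsum_lambertTerm_functional {p c : ℂ} (hp : ‖p‖ < 1) (hc : ‖c‖ < 1) :
    ∑' n, lambertTerm p c n = -c / (1 - c ^ 2) + ∑' n, lambertTerm p (c * p) n := by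
  have hcp : ‖c * p‖ < 1 := by simpa using norm_mul_pow_lt hc hp.le 1
  have e0 := one_sub_ne_zero_of_norm hc
  have e1 := one_add_ne_zero_of_norm hc
  -- The certificate is a rational multiple of the term; its value at 0 is the inhomogeneous part
  -- -c/(1-c²).
  have key := tsum_eq_of_telescope (t := lambertTerm p c) (s := lambertTerm p (c * p))
    (U := fun n => (1 - p ^ (n + 1)) * lambertTerm p c n / (1 + c))
    (summable_lambertTerm hp hc) (summable_lambertTerm hp hcp) ?_ ?_
  · rw [key]
    congr 1
    have e2 : 1 - p ≠ 0 := one_sub_ne_zero_of_norm hp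
    have e3 : 1 - c ^ 2 ≠ 0 := by
      rw [show 1 - c ^ 2 = (1 - c) * (1 + c) by ring]
      exact mul_ne_zero e0 e1
    simp only [lambertTerm, qPoch, Finset.prod_range_zero, Finset.prod_range_one, zero_add,
      pow_one, pow_zero, mul_one, one_mul]
    field_simp
    ring
  · intro n
    have f1 : 1 - p ^ (n + 1) ≠ 0 := one_sub_ne_zero_of_norm (norm_pow_succ_lt hp n)
    have f2 : 1 - p ^ (n + 1 + 1) ≠ 0 := one_sub_ne_zero_of_norm (norm_pow_succ_lt hp (n + 1))
    have f3 := qPoch_ne_zero_of_norm hcp hp.le (n + 1)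
    have f4 : 1 - c * p ^ (n + 1) ≠ 0 := one_sub_ne_zero_of_norm (norm_mul_pow_lt hc hp.le _)
    have f5 : qPoch c p (n + 1) = (1 - c) * qPoch (c * p) p (n + 1) / (1 - c * p ^ (n + 1)) := by
      rw [← qPoch_succ', qPoch_succ c p (n + 1)]
      field_simp
    simp only [lambertTerm]
    rw [qPoch_succ' c p (n + 1), f5, qPoch_succ (-p) p n]
    generalize qPoch (c * p) p (n + 1) = A at *
    generalize qPoch (-p) p n = B
    have f6 : (-(c * p)) ^ (n + 1) = (-c) ^ (n + 1) * p ^ (n + 1) := by rw [← mul_pow]; ring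
    rw [f6, pow_succ (-c) (n + 1), show -p * p ^ n = - p ^ (n + 1) by ring]
    generalize p ^ (n + 1) = y at *
    generalize (-c) ^ (n + 1) = z
    generalize p ^ (n + 1 + 1) = w at *
    field_simp
    ring
  · obtain ⟨C, hC⟩ := exists_norm_lambertTerm_le hp hc
    refine tendsto_zero_of_norm_le_pow (C := 2 * C * ‖(1 + c)⁻¹‖) (norm_nonneg c) hc fun n => ?_
    rw [div_eq_mul_inv, norm_mul, norm_mul]
    have h1 : ‖1 - p ^ (n + 1)‖ ≤ 2 := by
      refine (norm_sub_le _ _).trans ?_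
      have := (norm_pow_succ_lt hp n).le
      rw [norm_one]
      linarith
    calc _ ≤ 2 * (C * ‖c‖ ^ (n + 1)) * ‖(1 + c)⁻¹‖ := by
          gcongr
          exact hC c n le_rfl
      _ = _ := by ring

theorem tendsto_sum_lambert {p c : ℂ} (hp : ‖p‖ < 1) (hc : ‖c‖ < 1) :
    Tendsto (fun K : ℕ => ∑ k ∈ Finset.range K, -(c * p ^ k) / (1 - (c * p ^ k) ^ 2)) atTop
      (𝓝 (∑' n, lambertTerm p c n)) := by
  obtain ⟨C, hC⟩ := exists_norm_lambertTerm_le hp hc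
  refine tendsto_sum_of_functional_eq (f := fun c => ∑' n, lambertTerm p c n)
    (g := fun x => -x / (1 - x ^ 2)) (fun k => ?_)
    (tendsto_tsum_mul_pow_zero (C := C) hc hp hC)
  have := tsum_lambertTerm_functional hp (norm_mul_pow_lt hc hp.le k)
  rwa [mul_assoc, ← pow_succ] at this

/-- The general term (shifted by one) of `∑_{n ≥ 1} c^n p^{n(n-1)/2} (-p; p)_{n-1}
(1 - c p^{2n-1}) / ((1 - p^n) (1 - c p^{n-1}) (-c; p)_n)`. -/
noncomputable def quadraticLambertTerm (p c : ℂ) (n : ℕ) : ℂ :=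
  c ^ (n + 1) * p ^ ((n + 1) * n / 2) * qPoch (-p) p n * (1 - c * p ^ (2 * n + 1)) /
    ((1 - p ^ (n + 1)) * (1 - c * p ^ n) * qPoch (-c) p (n + 1))

theorem exists_norm_quadraticLambertTerm_le {p : ℂ} {r : ℝ} (hp : ‖p‖ < 1) (hr1 : r < 1) :
    ∃ C : ℝ, ∀ (x : ℂ) (n : ℕ), ‖x‖ ≤ r →
      ‖quadraticLambertTerm p x n‖ ≤ C * ‖x‖ ^ (n + 1) := by
  refine ⟨Real.exp (1 / (1 - ‖p‖)) * 2 * ((1 - ‖p‖)⁻¹ * (1 - r)⁻¹ *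
    Real.exp (r / (1 - r) / (1 - ‖p‖))), fun x n hx => ?_⟩
  have h1 := norm_qPoch_le (a := -p) (s := 1) (by simpa using hp.le) hp n
  have h2 := norm_inv_one_sub_pow_le hp n
  have h3 := norm_inv_qPoch_le (a := -x) (by simpa using hx) hr1 hp (n + 1)
  have h4 := norm_inv_one_sub_le ((norm_mul_pow_le hp.le n).trans hx) hr1
  have h5 : ‖1 - x * p ^ (2 * n + 1)‖ ≤ 2 := by
    refine (norm_sub_le _ _).trans ?_
    have := (norm_mul_pow_le (a := x) hp.le (2 * n + 1)).trans hx
    rw [norm_one]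
    linarith
  have h6 : ‖p ^ ((n + 1) * n / 2)‖ ≤ 1 := by
    rw [norm_pow]
    exact pow_le_one₀ (norm_nonneg p) hp.le
  have h0 : 0 < 1 - ‖p‖ := by linarith
  have h0' : 0 < 1 - r := by linarith
  rw [quadraticLambertTerm, div_eq_mul_inv, mul_inv, mul_inv, norm_mul, norm_mul, norm_mul,
    norm_mul, norm_mul, norm_mul, norm_pow]
  calc _ ≤ ‖x‖ ^ (n + 1) * 1 * Real.exp (1 / (1 - ‖p‖)) * 2 *
        ((1 - ‖p‖)⁻¹ * (1 - r)⁻¹ * Real.exp (r / (1 - r) / (1 - ‖p‖))) := by gcongr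
    _ = _ := by ring

theorem summable_quadraticLambertTerm {p c : ℂ} (hp : ‖p‖ < 1) (hc : ‖c‖ < 1) :
    Summable (quadraticLambertTerm p c) := by
  obtain ⟨C, hC⟩ := exists_norm_quadraticLambertTerm_le hp hc
  exact summable_of_norm_le_pow (norm_nonneg c) hc fun n => hC c n le_rfl

theorem succ_mul_div_two (n : ℕ) : (n + 1 + 1) * (n + 1) / 2 = (n + 1) * n / 2 + (n + 1) := by
  rw [show (n + 1 + 1) * (n + 1) = (n + 1) * n + (n + 1) * 2 by ring,
    Nat.add_mul_div_right _ _ two_pos]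

theorem tsum_quadraticLambertTerm_functional {p c : ℂ} (hp : ‖p‖ < 1) (hc : ‖c‖ < 1) :
    ∑' n, quadraticLambertTerm p c n =
      c / (1 - c ^ 2) + ∑' n, quadraticLambertTerm p (c * p) n := by
  have hcp : ‖c * p‖ < 1 := by simpa using norm_mul_pow_lt hc hp.le 1
  have e0 := one_sub_ne_zero_of_norm hc
  have e1 := one_add_ne_zero_of_norm hc
  -- Here the certificate starts at c/(1-c²), the opposite of its value for `lambertTerm`.
  have key := tsum_eq_of_telescope (t := quadraticLambertTerm p c)
    (s := quadraticLambertTerm p (c * p))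
    (U := fun n => c ^ (n + 1) * (p ^ ((n + 1) * n / 2) * qPoch (-p) p n *
      ((1 - c * p ^ n)⁻¹ * (qPoch (-c) p (n + 1))⁻¹)))
    (summable_quadraticLambertTerm hp hc) (summable_quadraticLambertTerm hp hcp) ?_ ?_
  · rw [key]
    congr 1
    have e3 : 1 - c ^ 2 ≠ 0 := by
      rw [show 1 - c ^ 2 = (1 - c) * (1 + c) by ring]
      exact mul_ne_zero e0 e1
    simp only [qPoch, Finset.prod_range_zero, Finset.prod_range_one, zero_add,
      pow_one, pow_zero, mul_one, one_mul, mul_zero, Nat.zero_div, sub_neg_eq_add]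
    field_simp
    ring
  · intro n
    have f1 : 1 - p ^ (n + 1) ≠ 0 := one_sub_ne_zero_of_norm (norm_pow_succ_lt hp n)
    have f3 := qPoch_ne_zero_of_norm (a := -(c * p)) (by simpa using hcp) hp.le (n + 1)
    have f4 : 1 - c * p ^ n ≠ 0 := one_sub_ne_zero_of_norm (norm_mul_pow_lt hc hp.le _)
    have f5 : 1 - c * p ^ (n + 1) ≠ 0 := one_sub_ne_zero_of_norm (norm_mul_pow_lt hc hp.le _)
    have f6 : 1 + c * p ^ (n + 1) ≠ 0 := one_add_ne_zero_of_norm (norm_mul_pow_lt hc hp.le _)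
    have f7 : qPoch (-c) p (n + 1) =
        (1 + c) * qPoch (-(c * p)) p (n + 1) / (1 + c * p ^ (n + 1)) := by
      rw [eq_div_iff f6]
      have := qPoch_succ' (-c) p (n + 1)
      rw [qPoch_succ (-c) p (n + 1)] at this
      rw [← neg_mul, ← sub_neg_eq_add 1 c, ← this]
      ring
    have f8 : 1 - c * p * p ^ n ≠ 0 := by rwa [mul_assoc, ← pow_succ']
    simp only [quadraticLambertTerm]
    rw [qPoch_succ' (-c) p (n + 1), f7, qPoch_succ (-p) p n, succ_mul_div_two, pow_add p _ (n + 1),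
      mul_pow c p, pow_succ c (n + 1), neg_mul c p]
    generalize qPoch (-(c * p)) p (n + 1) = A at *
    generalize qPoch (-p) p n = B
    generalize p ^ ((n + 1) * n / 2) = D
    rw [show p ^ (2 * n + 1) = p ^ n * p ^ (n + 1) by ring]
    have hy : p ^ (n + 1) = p ^ n * p := pow_succ p n
    rw [hy] at f1 f5 f6 ⊢
    generalize p ^ n = y at *
    generalize c ^ (n + 1) = z
    have f9 : 1 - c * y * p ≠ 0 := by rwa [mul_assoc]
    rw [show c * p * y = c * y * p by ring, show c * (y * p) = c * y * p by ring]
    have f12 : 1 + c ≠ 0 := e1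
    have f13 : 1 - -c = 1 + c := by ring
    rw [f13]
    field_simp
    ring
  · have hb1 : ∀ n, ‖qPoch (-p) p n‖ ≤ Real.exp (1 / (1 - ‖p‖)) := fun n =>
      norm_qPoch_le (a := -p) (s := 1) (by simpa using hp.le) hp n
    refine tendsto_zero_of_norm_le_pow (C := 1 * Real.exp (1 / (1 - ‖p‖)) *
      ((1 - ‖c‖)⁻¹ * Real.exp (‖c‖ / (1 - ‖c‖) / (1 - ‖p‖)))) (norm_nonneg c) hc fun n => ?_
    have h3 := norm_inv_qPoch_le (a := -c) (norm_neg c).le hc hp (n + 1)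
    have h4 := norm_inv_one_sub_le (norm_mul_pow_le (a := c) hp.le n) hc
    have h6 : ‖p ^ ((n + 1) * n / 2)‖ ≤ 1 := by
      rw [norm_pow]
      exact pow_le_one₀ (norm_nonneg p) hp.le
    have h0 : 0 < 1 - ‖c‖ := by linarith
    rw [norm_mul, norm_mul, norm_mul, norm_mul, norm_pow, mul_comm]
    gcongr
    exact hb1 n

theorem tendsto_sum_quadraticLambert {p c : ℂ} (hp : ‖p‖ < 1) (hc : ‖c‖ < 1) :
    Tendsto (fun K : ℕ => ∑ k ∈ Finset.range K, (c * p ^ k) / (1 - (c * p ^ k) ^ 2)) atTop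
      (𝓝 (∑' n, quadraticLambertTerm p c n)) := by
  obtain ⟨C, hC⟩ := exists_norm_quadraticLambertTerm_le hp hc
  refine tendsto_sum_of_functional_eq (f := fun c => ∑' n, quadraticLambertTerm p c n)
    (g := fun x => x / (1 - x ^ 2)) (fun k => ?_)
    (tendsto_tsum_mul_pow_zero (C := C) hc hp hC)
  have := tsum_quadraticLambertTerm_functional hp (norm_mul_pow_lt hc hp.le k)
  rwa [mul_assoc, ← pow_succ] at this

theorem tsum_quadraticLambertTerm {p c : ℂ} (hp : ‖p‖ < 1) (hc : ‖c‖ < 1) :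
    ∑' n, quadraticLambertTerm p c n = -∑' n, lambertTerm p c n := by
  refine tendsto_nhds_unique (tendsto_sum_quadraticLambert hp hc) ?_
  have := (tendsto_sum_lambert hp hc).neg
  simpa only [neg_div, Finset.sum_neg_distrib, neg_neg] using this

/-! ### Gauss's product for ψ. -/

/-- The partial products of `∏ (1 - q^{2k}) / (1 - q^{2k-1})`. -/
noncomputable def psiProd (q : ℂ) (n : ℕ) : ℂ :=
  qPoch (q ^ 2) (q ^ 2) n / qPoch q (q ^ 2) n

theorem norm_sq_lt {q : ℂ} (hq : ‖q‖ < 1) : ‖q ^ 2‖ < 1 := norm_pow_succ_lt hq 1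

theorem psiProd_ne_zero {q : ℂ} (hq : ‖q‖ < 1) (n : ℕ) : psiProd q n ≠ 0 :=
  div_ne_zero (qPoch_ne_zero_of_norm (norm_sq_lt hq) (norm_sq_lt hq).le n)
    (qPoch_ne_zero_of_norm hq (norm_sq_lt hq).le n)

theorem psiProd_succ (q : ℂ) (n : ℕ) :
    psiProd q (n + 1) = psiProd q n * ((1 - q ^ (2 * n + 2)) / (1 - q ^ (2 * n + 1))) := by
  rw [psiProd, psiProd, qPoch_succ, qPoch_succ, div_mul_div_comm]
  congr 3 <;> ring

theorem exists_norm_psiProd_le {q : ℂ} (hq : ‖q‖ < 1) :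
    ∃ C : ℝ, 0 < C ∧ ∀ n, ‖psiProd q n‖ ≤ C ∧ ‖(psiProd q n)⁻¹‖ ≤ C := by
  have h2 := norm_sq_lt hq
  obtain ⟨C₁, hC₁, h₁⟩ := exists_norm_inv_qPoch_le q h2
  obtain ⟨C₂, hC₂, h₂⟩ := exists_norm_inv_qPoch_le (q ^ 2) h2
  set D := Real.exp (1 / (1 - ‖q ^ 2‖))
  refine ⟨D * C₁ + D * C₂, by positivity, fun n => ⟨?_, ?_⟩⟩
  · rw [psiProd, div_eq_mul_inv, norm_mul]
    have := mul_le_mul (norm_qPoch_le h2.le h2 n) (h₁ n) (norm_nonneg _) (by positivity)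
    have h3 : 0 < D * C₂ := by positivity
    linarith
  · rw [psiProd, inv_div, div_eq_mul_inv, norm_mul]
    have := mul_le_mul (norm_qPoch_le hq.le h2 n) (h₂ n) (norm_nonneg _) (by positivity)
    have h3 : 0 < D * C₁ := by positivity
    linarith

/-- A finite form of Gauss's product for `ψ`. -/
theorem sum_triangular_eq {q : ℂ} (hq : ‖q‖ < 1) (n : ℕ) :
    ∑ k ∈ Finset.range (2 * n + 1), q ^ (k * (k + 1) / 2) =
      ∑ s ∈ Finset.range (n + 1), psiProd q n / psiProd q s * q ^ (s * (2 * n + 1)) := by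
  induction n with
  | zero => simp [psiProd_ne_zero hq]
  | succ n ih =>
    have e1 : (2 * n + 1) * (2 * n + 1 + 1) / 2 = (n + 1) * (2 * n + 1) := by
      rw [show (2 * n + 1) * (2 * n + 1 + 1) = ((n + 1) * (2 * n + 1)) * 2 by ring]
      exact Nat.mul_div_cancel _ two_pos
    have e2 : (2 * n + 1 + 1) * (2 * n + 1 + 1 + 1) / 2 = (n + 1) * (2 * (n + 1) + 1) := by
      rw [show (2 * n + 1 + 1) * (2 * n + 1 + 1 + 1) = ((n + 1) * (2 * (n + 1) + 1)) * 2 by ring]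
      exact Nat.mul_div_cancel _ two_pos
    rw [show 2 * (n + 1) + 1 = 2 * n + 1 + 1 + 1 by ring, Finset.sum_range_succ,
      Finset.sum_range_succ, ih, e1, e2, Finset.sum_range_succ _ (n + 1),
      show 2 * n + 1 + 1 + 1 = 2 * (n + 1) + 1 by ring,
      div_self (psiProd_ne_zero hq _), one_mul]
    congr 1
    have hd : 1 - q ^ (2 * n + 1) ≠ 0 := one_sub_ne_zero_of_norm (norm_pow_succ_lt hq _)
    -- Telescoping in s compares the right sides for n and n+1. `U 0` vanishes, `U (n + 1)` is the
    -- new triangular power with k = 2n+1, and the extra summand s = n+1, already removed, is the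
    -- one with k = 2n+2.
    set U : ℕ → ℂ := fun s => psiProd q n / ((1 - q ^ (2 * n + 1)) * psiProd q s) *
      q ^ (s * (2 * n + 1)) * (1 - q ^ (2 * s)) with hU
    have hstep : ∀ s, psiProd q (n + 1) / psiProd q s * q ^ (s * (2 * (n + 1) + 1)) =
        psiProd q n / psiProd q s * q ^ (s * (2 * n + 1)) + (U (s + 1) - U s) := by
      intro s
      have hs := psiProd_ne_zero hq s
      have hs1 : 1 - q ^ (2 * s + 1) ≠ 0 := one_sub_ne_zero_of_norm (norm_pow_succ_lt hq _)
      have hs2 : 1 - q ^ (2 * s + 2) ≠ 0 := one_sub_ne_zero_of_norm (norm_pow_succ_lt hq _)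
      simp only [hU]
      rw [psiProd_succ q n, psiProd_succ q s, mul_add 2 s 1, mul_one,
        show s * (2 * (n + 1) + 1) = s * (2 * n + 1) + 2 * s by ring,
        show (s + 1) * (2 * n + 1) = s * (2 * n + 1) + (2 * n + 1) by ring,
        pow_add q (s * (2 * n + 1)), pow_add q (s * (2 * n + 1)), pow_succ q (2 * s),
        show q ^ (2 * n + 2) = q ^ (2 * n + 1) * q by ring] at *
      generalize q ^ (2 * n + 1) = y at *
      generalize q ^ (2 * s) = z at *
      generalize q ^ (2 * s + 2) = w at *
      generalize psiProd q s = A at *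
      field_simp
      ring
    rw [Finset.sum_congr rfl fun s _ => hstep s, Finset.sum_add_distrib, Finset.sum_range_sub]
    congr 1
    have hn2 : 1 - q ^ (2 * n + 2) ≠ 0 := one_sub_ne_zero_of_norm (norm_pow_succ_lt hq _)
    have hn := psiProd_ne_zero hq n
    simp only [hU]
    rw [psiProd_succ q n, mul_add 2 n 1, mul_one]
    simp only [mul_zero, pow_zero, sub_self, sub_zero]
    field_simp

theorem hasSum_ramanujanPsi {q : ℂ} (hq : ‖q‖ < 1) :
    HasSum (fun n : ℕ => q ^ (n * (n + 1) / 2)) (ramanujanPsi q) := by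
  refine Summable.hasSum (Summable.of_norm_bounded
    (summable_geometric_of_lt_one (norm_nonneg q) hq) fun n => ?_)
  rw [norm_pow]
  refine pow_le_pow_of_le_one (norm_nonneg q) hq.le ?_
  rw [Nat.le_div_iff_mul_le two_pos]
  rcases Nat.eq_zero_or_pos n with rfl | h
  · simp
  · exact Nat.mul_le_mul_left n (by omega)

/-- Gauss: `ψ(q) = ∏ (1 - q^{2k}) / (1 - q^{2k-1})`. -/
theorem tendsto_psiProd {q : ℂ} (hq : ‖q‖ < 1) :
    Tendsto (psiProd q) atTop (𝓝 (ramanujanPsi q)) := by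
  obtain ⟨C, hC, hb⟩ := exists_norm_psiProd_le hq
  have h1 : Tendsto (fun n : ℕ => ∑ k ∈ Finset.range (2 * n + 1), q ^ (k * (k + 1) / 2)) atTop
      (𝓝 (ramanujanPsi q)) :=
    (hasSum_ramanujanPsi hq).tendsto_sum_nat.comp
      (tendsto_atTop_mono (fun n => by simp only [id]; omega) tendsto_id)
  -- The summand s = 0 of the finite form is the partial product itself; the others are O(|q|^{n+s})
  -- and disappear in the limit.
  have h2 : ∀ n, psiProd q n = (∑ k ∈ Finset.range (2 * n + 1), q ^ (k * (k + 1) / 2)) -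
      ∑ s ∈ Finset.range n, psiProd q n / psiProd q (s + 1) * q ^ ((s + 1) * (2 * n + 1)) := by
    intro n
    rw [sum_triangular_eq hq, Finset.sum_range_succ']
    simp [psiProd, qPoch]
  have h3 : Tendsto (fun n : ℕ => ∑ s ∈ Finset.range n,
      psiProd q n / psiProd q (s + 1) * q ^ ((s + 1) * (2 * n + 1))) atTop (𝓝 0) := by
    refine squeeze_zero_norm (a := fun n => C * C * (1 - ‖q‖)⁻¹ * ‖q‖ ^ n) (fun n => ?_) ?_
    · refine (norm_sum_le _ _).trans ?_
      calc _ ≤ ∑ s ∈ Finset.range n, C * C * (‖q‖ ^ n * ‖q‖ ^ s) := by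
            refine Finset.sum_le_sum fun s _ => ?_
            rw [norm_mul, div_eq_mul_inv, norm_mul, norm_pow, ← pow_add]
            have h4 : ‖q‖ ^ ((s + 1) * (2 * n + 1)) ≤ ‖q‖ ^ (n + s) :=
              pow_le_pow_of_le_one (norm_nonneg q) hq.le (by nlinarith)
            have h5 := (hb n).1
            have h6 := (hb (s + 1)).2
            gcongr
        _ = C * C * ‖q‖ ^ n * ∑ s ∈ Finset.range n, ‖q‖ ^ s := by
            rw [Finset.mul_sum]
            exact Finset.sum_congr rfl fun s _ => by ring
        _ ≤ C * C * ‖q‖ ^ n * (1 - ‖q‖)⁻¹ := by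
            gcongr
            rw [← tsum_geometric_of_lt_one (norm_nonneg q) hq]
            exact (summable_geometric_of_lt_one (norm_nonneg q) hq).sum_le_tsum _
              fun i _ => by positivity
        _ = _ := by ring
    · simpa using (tendsto_pow_atTop_nhds_zero_of_lt_one (norm_nonneg q) hq).const_mul
        (C * C * (1 - ‖q‖)⁻¹)
  rw [show psiProd q = _ from funext h2]
  simpa using h1.sub h3

theorem ramanujanPsi_ne_zero {q : ℂ} (hq : ‖q‖ < 1) : ramanujanPsi q ≠ 0 := by
  obtain ⟨C, hC, hb⟩ := exists_norm_psiProd_le hq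
  intro h0
  have h1 : ∀ n, C⁻¹ ≤ ‖psiProd q n‖ := fun n => by
    have := (hb n).2
    rw [norm_inv] at this
    exact inv_le_of_inv_le₀ (norm_pos_iff.mpr (psiProd_ne_zero hq n)) this
  have h2 := ge_of_tendsto' (tendsto_psiProd hq).norm h1
  rw [h0, norm_zero] at h2
  exact absurd (inv_pos.mpr hC) (not_lt.mpr h2)

/-! ### Partial fractions and the theta quotient. -/

/-- Partial fractions of `∏ (b - y l) / (b - v l)`. -/
theorem prod_sub_div_prod_sub {M : ℕ} {v y : ℕ → ℂ} {b : ℂ}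
    (hv : Set.InjOn v (Finset.range M)) (hb : ∀ i ∈ Finset.range M, b ≠ v i) :
    (∏ l ∈ Finset.range M, (b - y l)) / ∏ l ∈ Finset.range M, (b - v l) =
      1 + ∑ i ∈ Finset.range M, (∏ l ∈ Finset.range M, (v i - y l)) /
        (∏ l ∈ (Finset.range M).erase i, (v i - v l)) / (b - v i) := by
  set s := Finset.range M
  have hne : ∏ l ∈ s, (b - v l) ≠ 0 :=
    Finset.prod_ne_zero_iff.mpr fun i hi => sub_ne_zero.mpr (hb i hi)
  -- Two monic polynomials of the same degree: their difference has smaller degree, so it equals its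
  -- Lagrange interpolant at the nodes `v`.
  have hdeg : (Lagrange.nodal s y - Lagrange.nodal s v).degree < s.card := by
    have h := Polynomial.degree_sub_lt_left (p := Lagrange.nodal s y) (q := Lagrange.nodal s v)
      (by rw [Lagrange.degree_nodal, Lagrange.degree_nodal]) Lagrange.nodal_ne_zero
      (by rw [Lagrange.nodal_monic.leadingCoeff, Lagrange.nodal_monic.leadingCoeff])
    rwa [Lagrange.degree_nodal] at h
  have h1 := congrArg (Polynomial.eval b) (Lagrange.eq_interpolate hv hdeg)
  rw [Lagrange.eval_interpolate_not_at_node _ hb] at h1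
  simp only [Polynomial.eval_sub, Lagrange.eval_nodal] at h1
  rw [div_eq_iff hne, add_mul, one_mul, ← sub_eq_iff_eq_add', h1, mul_comm]
  congr 1
  refine Finset.sum_congr rfl fun i hi => ?_
  have h2 : ∏ l ∈ s, (v i - v l) = 0 := Finset.prod_eq_zero hi (sub_self _)
  rw [h2, sub_zero, Lagrange.nodalWeight, Finset.prod_inv_distrib]
  ring

theorem prod_erase_range {i m : ℕ} (f : ℕ → ℂ) :
    ∏ l ∈ (Finset.range (i + 1 + m)).erase i, f l =
      (∏ l ∈ Finset.range i, f l) * ∏ s ∈ Finset.range m, f (i + 1 + s) := by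
  have hi : i ∈ Finset.range (i + 1 + m) := Finset.mem_range.mpr (by omega)
  have h1 := Finset.mul_prod_erase _ (Function.update f i 1) hi
  rw [Function.update_self, one_mul, Finset.prod_range_add, Finset.prod_range_succ,
    Function.update_self, mul_one] at h1
  rw [Finset.prod_congr rfl (g := Function.update f i 1) fun l hl =>
    (Function.update_of_ne (Finset.ne_of_mem_erase hl) _ _).symm, h1]
  congr 1
  · refine Finset.prod_congr rfl fun l hl => Function.update_of_ne ?_ _ _
    exact (Finset.mem_range.mp hl).ne
  · exact Finset.prod_congr rfl fun s _ => Function.update_of_ne (by omega) _ _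

theorem prod_range_const_mul (c : ℂ) (f : ℕ → ℂ) (n : ℕ) :
    ∏ l ∈ Finset.range n, c * f l = c ^ n * ∏ l ∈ Finset.range n, f l := by
  rw [Finset.prod_mul_distrib, Finset.prod_const, Finset.card_range]

/-- Removing the factor l = 0 and a power of p from the rest gives the same recursion in i for both
products. The cross-multiplied form avoids any nonvanishing hypothesis. -/
theorem prod_mul_pow_sub_pow (p z : ℂ) (i : ℕ) :
    (∏ l ∈ Finset.range i, (z * p ^ i - p ^ l)) * qPoch p p i =
      qPoch (z * p) p i * ∏ l ∈ Finset.range i, (p ^ i - p ^ l) := by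
  have hstep : ∀ (w : ℂ) (i : ℕ), ∏ l ∈ Finset.range (i + 1), (w * p ^ (i + 1) - p ^ l) =
      (w * p ^ (i + 1) - 1) * (p ^ i * ∏ l ∈ Finset.range i, (w * p ^ i - p ^ l)) := by
    intro w i
    rw [Finset.prod_range_succ', pow_zero, mul_comm]
    congr 1
    calc ∏ l ∈ Finset.range i, (w * p ^ (i + 1) - p ^ (l + 1))
        = ∏ l ∈ Finset.range i, p * (w * p ^ i - p ^ l) :=
          Finset.prod_congr rfl fun l _ => by ring
      _ = _ := prod_range_const_mul _ _ _
  have h1 : ∀ i : ℕ, ∏ l ∈ Finset.range i, (p ^ i - p ^ l) =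
      ∏ l ∈ Finset.range i, (1 * p ^ i - p ^ l) := fun i => by simp
  rw [h1]
  induction i with
  | zero => simp [qPoch]
  | succ i ih =>
    rw [hstep, hstep, qPoch_succ, qPoch_succ]
    linear_combination (1 - p * p ^ i) * (z * p ^ (i + 1) - 1) * p ^ i * ih

theorem pow_injective_of_norm {x : ℂ} (h0 : x ≠ 0) (h1 : ‖x‖ < 1) :
    Function.Injective fun n : ℕ => x ^ n := by
  intro m n h
  have h2 : ‖x‖ ^ m = ‖x‖ ^ n := by simpa using congrArg norm h
  exact (pow_right_injective₀ (norm_pos_iff.mpr h0) h1.ne) h2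

/-- The residue at the node x^{2i}, which has i nodes before it and m after it. Each group yields
the reciprocal of a partial product of ψ(x), whence the factor 1/ψ(x)² when i and m both grow. -/
theorem partialFraction_weight {x : ℂ} (h0 : x ≠ 0) (h1 : ‖x‖ < 1) (i m : ℕ) :
    (∏ l ∈ Finset.range (i + 1 + m), ((x ^ 2) ^ i - (x ^ 2) ^ l / x)) /
      (∏ l ∈ (Finset.range (i + 1 + m)).erase i, ((x ^ 2) ^ i - (x ^ 2) ^ l)) =
    -(x ^ i / x) * ((1 - x * (x ^ 2) ^ i) / (psiProd x i * psiProd x m)) := by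
  have hp1 := norm_sq_lt h1
  have hp0 : x ^ 2 ≠ 0 := pow_ne_zero 2 h0
  rw [prod_erase_range, Finset.prod_range_add, Finset.prod_range_succ]
  have hA : ∏ l ∈ Finset.range i, ((x ^ 2) ^ i - (x ^ 2) ^ l / x) =
      (x⁻¹) ^ i * ∏ l ∈ Finset.range i, (x * (x ^ 2) ^ i - (x ^ 2) ^ l) := by
    rw [← prod_range_const_mul]
    refine Finset.prod_congr rfl fun l _ => ?_
    field_simp
  have hB : ∏ s ∈ Finset.range m, ((x ^ 2) ^ i - (x ^ 2) ^ (i + 1 + s) / x) =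
      ((x ^ 2) ^ i) ^ m * qPoch x (x ^ 2) m := by
    rw [qPoch, ← prod_range_const_mul]
    refine Finset.prod_congr rfl fun l _ => ?_
    rw [pow_add, pow_add]
    field_simp
  have hC : ∏ s ∈ Finset.range m, ((x ^ 2) ^ i - (x ^ 2) ^ (i + 1 + s)) =
      ((x ^ 2) ^ i) ^ m * qPoch (x ^ 2) (x ^ 2) m := by
    rw [qPoch, ← prod_range_const_mul]
    refine Finset.prod_congr rfl fun l _ => ?_
    rw [pow_add, pow_add]
    ring
  have hD := prod_mul_pow_sub_pow (x ^ 2) x i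
  have hE : ∏ l ∈ Finset.range i, ((x ^ 2) ^ i - (x ^ 2) ^ l) ≠ 0 := by
    refine Finset.prod_ne_zero_iff.mpr fun l hl => sub_ne_zero.mpr fun h => ?_
    exact (Finset.mem_range.mp hl).ne' (pow_injective_of_norm hp0 hp1 h)
  have hF := qPoch_ne_zero_of_norm hp1 hp1.le i
  have hG := qPoch_ne_zero_of_norm hp1 hp1.le m
  have hH := qPoch_ne_zero_of_norm h1 hp1.le m
  have hI := qPoch_ne_zero_of_norm h1 hp1.le i
  have hJ : qPoch x (x ^ 2) i * (1 - x * (x ^ 2) ^ i) = (1 - x) * qPoch (x * x ^ 2) (x ^ 2) i := by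
    rw [← qPoch_succ, qPoch_succ']
  rw [hA, hB, hC, psiProd, psiProd]
  rw [← eq_div_iff hF] at hD
  rw [hD]
  have hK : 1 - x * (x ^ 2) ^ i = (1 - x) * qPoch (x * x ^ 2) (x ^ 2) i / qPoch x (x ^ 2) i := by
    rw [eq_div_iff hI, ← hJ, mul_comm]
  rw [hK]
  have hP : ((x ^ 2) ^ i) = x ^ i * x ^ i := by rw [← pow_mul, two_mul, pow_add]
  have hP0 : ((x ^ 2) ^ i) ^ m ≠ 0 := pow_ne_zero _ (pow_ne_zero _ hp0)
  have hx0 : x ^ i ≠ 0 := pow_ne_zero _ h0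
  generalize ((x ^ 2) ^ i) ^ m = Y at *
  generalize ∏ l ∈ Finset.range i, ((x ^ 2) ^ i - (x ^ 2) ^ l) = E at *
  rw [hP, inv_pow]
  generalize x ^ i = X at *
  generalize qPoch (x * x ^ 2) (x ^ 2) i = Q at *
  generalize qPoch x (x ^ 2) i = Q1 at *
  generalize qPoch x (x ^ 2) m = Q2 at *
  generalize qPoch (x ^ 2) (x ^ 2) i = Q3 at *
  generalize qPoch (x ^ 2) (x ^ 2) m = Q4 at *
  field_simp
  ring

/-- Tannery's theorem for truncated weighted sums, by extending the summand by zero. -/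
theorem tendsto_sum_mul_of_bounded {w : ℕ → ℕ → ℂ} {a : ℕ → ℂ} {W : ℂ} {C : ℝ}
    (ha : Summable fun k => ‖a k‖) (hw : ∀ N k, k < N → ‖w N k‖ ≤ C)
    (hlim : ∀ k, Tendsto (fun N => w N k) atTop (𝓝 W)) :
    Tendsto (fun N => ∑ k ∈ Finset.range N, w N k * a k) atTop (𝓝 (W * ∑' k, a k)) := by
  have h1 : ∀ N, ∑ k ∈ Finset.range N, w N k * a k =
      ∑' k, if k < N then w N k * a k else 0 := by
    intro N
    rw [tsum_eq_sum (s := Finset.range N) fun k hk => if_neg (by simpa using hk)]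
    exact Finset.sum_congr rfl fun k hk => (if_pos (Finset.mem_range.mp hk)).symm
  simp only [h1]
  rw [← tsum_mul_left]
  refine tendsto_tsum_of_dominated_convergence (bound := fun k => |C| * ‖a k‖) (ha.mul_left _)
    (fun k => ?_) (Eventually.of_forall fun N k => ?_)
  · refine ((hlim k).mul_const (a k)).congr' ?_
    filter_upwards [eventually_gt_atTop k] with N hN
    rw [if_pos hN]
  · split_ifs with h
    · rw [norm_mul]
      gcongr
      exact (hw N k h).trans (le_abs_self C)
    · rw [norm_zero]
      positivity

theorem qPoch_three_mul (q : ℂ) (b : ℂ) (n : ℕ) :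
    qPoch b (q ^ 2) (3 * n) =
      qPoch b (q ^ 6) n * qPoch (b * q ^ 2) (q ^ 6) n * qPoch (b * q ^ 4) (q ^ 6) n := by
  induction n with
  | zero => simp [qPoch]
  | succ n ih =>
    rw [show 3 * (n + 1) = 3 * n + 1 + 1 + 1 by ring]
    simp only [qPoch_succ, ih, ← pow_mul]
    ring

theorem pow_three_sq (q : ℂ) : (q ^ 3) ^ 2 = q ^ 6 := by rw [← pow_mul]

theorem norm_cube_lt {q : ℂ} (hq : ‖q‖ < 1) : ‖q ^ 3‖ < 1 := norm_pow_succ_lt hq 2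

/-- Finite form of the Lambert series expansion of `q ψ(q^3)^3 / ψ(q)`. -/
theorem finite_lambert {q : ℂ} (h0 : q ≠ 0) (hq : ‖q‖ < 1) (N : ℕ) :
    ∑ k ∈ Finset.range N, (1 - q ^ 3 * (q ^ 6) ^ (N + k)) *
        ((psiProd (q ^ 3) (N + k))⁻¹ * (psiProd (q ^ 3) (N - 1 - k))⁻¹) *
        (q ^ (3 * k + 1) / (1 - q ^ (6 * k + 2))) -
      ∑ k ∈ Finset.range N, (1 - q ^ 3 * (q ^ 6) ^ (N - 1 - k)) *
        ((psiProd (q ^ 3) (N + k))⁻¹ * (psiProd (q ^ 3) (N - 1 - k))⁻¹) *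
        (q ^ (3 * k + 2) / (1 - q ^ (6 * k + 4))) =
      q ^ 2 * (q ^ 3) ^ N - q ^ 2 * (qPoch q⁻¹ (q ^ 6) N * qPoch (q ^ 7) (q ^ 6) N /
        (qPoch (q ^ 2) (q ^ 6) N * qPoch (q ^ 4) (q ^ 6) N)) := by
  have hx0 : q ^ 3 ≠ 0 := pow_ne_zero 3 h0
  have hx1 := norm_cube_lt hq
  have hinj := pow_injective_of_norm h0 hq
  have hinj6 : Function.Injective fun n : ℕ => (q ^ 6) ^ n :=
    pow_injective_of_norm (pow_ne_zero 6 h0) (norm_pow_succ_lt hq 5)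
  have hp : ∀ n, (q ^ 6) ^ n ≠ 0 := fun n => pow_ne_zero n (pow_ne_zero 6 h0)
  have hb : ∀ i ∈ Finset.range (N + N), (q ^ 6) ^ N / q ^ 2 ≠ (q ^ 6) ^ i := by
    intro i _ h
    rw [div_eq_iff (pow_ne_zero 2 h0), ← pow_mul, ← pow_mul, ← pow_add] at h
    have := hinj h
    omega
  -- The point q^{6N-2} lies between the two halves of the 2N nodes q^{6i}. It differs from node N+k
  -- by a multiple of 1 - q^{6k+2}, and from node N-1-k by a multiple of 1 - q^{6k+4}: the two
  -- Lambert denominators.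
  have key := prod_sub_div_prod_sub (M := N + N) (v := fun i => (q ^ 6) ^ i)
    (y := fun l => (q ^ 6) ^ l / q ^ 3) (b := (q ^ 6) ^ N / q ^ 2)
    (hinj6.injOn) hb
  have hden : ∀ k a : ℕ, 1 - q ^ (6 * k + (a + 1)) ≠ 0 := fun k a =>
    one_sub_ne_zero_of_norm (norm_pow_succ_lt hq _)
  have hX : (q ^ 3) ^ N ≠ 0 := pow_ne_zero N hx0
  have hlhs : (∏ l ∈ Finset.range (N + N), ((q ^ 6) ^ N / q ^ 2 - (q ^ 6) ^ l / q ^ 3)) /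
      ∏ l ∈ Finset.range (N + N), ((q ^ 6) ^ N / q ^ 2 - (q ^ 6) ^ l) =
      ((q ^ 3) ^ N)⁻¹ * (qPoch q⁻¹ (q ^ 6) N * qPoch (q ^ 7) (q ^ 6) N /
        (qPoch (q ^ 2) (q ^ 6) N * qPoch (q ^ 4) (q ^ 6) N)) := by
    rw [← Finset.prod_div_distrib, Finset.prod_range_add, ← Finset.prod_range_reflect]
    have h1 : ∀ k ∈ Finset.range N,
        ((q ^ 6) ^ N / q ^ 2 - (q ^ 6) ^ (N - 1 - k) / q ^ 3) /
          ((q ^ 6) ^ N / q ^ 2 - (q ^ 6) ^ (N - 1 - k)) =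
        (q ^ 3)⁻¹ * ((1 - q ^ 7 * (q ^ 6) ^ k) / (1 - q ^ 4 * (q ^ 6) ^ k)) := by
      intro k hk
      have hk' : N = (N - 1 - k) + (k + 1) := by have := Finset.mem_range.mp hk; omega
      have e1 : (q ^ 6) ^ N = (q ^ 6) ^ (N - 1 - k) * (q ^ 6 * (q ^ 6) ^ k) := by
        conv_lhs => rw [hk', pow_add, pow_succ' (q ^ 6) k]
      have e2 := hden k 3
      rw [pow_add, pow_mul] at e2
      rw [e1]
      have e3 := hp (N - 1 - k)
      generalize (q ^ 6) ^ (N - 1 - k) = A at *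
      generalize (q ^ 6) ^ k = B at *
      have e4 : 1 - q ^ 4 * B ≠ 0 := by rwa [mul_comm]
      have e5 : A * (q ^ 6 * B) / q ^ 2 - A = - (A * (1 - q ^ 4 * B)) := by
        field_simp
        ring
      have e6 : A * (q ^ 6 * B) / q ^ 2 - A / q ^ 3 = - (A * (q ^ 3)⁻¹ * (1 - q ^ 7 * B)) := by
        field_simp
        ring
      rw [e5, e6]
      field_simp
    have h2 : ∀ k ∈ Finset.range N,
        ((q ^ 6) ^ N / q ^ 2 - (q ^ 6) ^ (N + k) / q ^ 3) /
          ((q ^ 6) ^ N / q ^ 2 - (q ^ 6) ^ (N + k)) =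
        (1 - q⁻¹ * (q ^ 6) ^ k) / (1 - q ^ 2 * (q ^ 6) ^ k) := by
      intro k _
      have e2 := hden k 1
      rw [pow_add, pow_mul] at e2
      rw [pow_add]
      have e3 := hp N
      generalize (q ^ 6) ^ N = A at *
      generalize (q ^ 6) ^ k = B at *
      have e4 : 1 - q ^ 2 * B ≠ 0 := by rwa [mul_comm]
      have e5 : A / q ^ 2 - A * B = A / q ^ 2 * (1 - q ^ 2 * B) := by
        field_simp
      have e6 : A / q ^ 2 - A * B / q ^ 3 = A / q ^ 2 * (1 - q⁻¹ * B) := by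
        field_simp
      rw [e5, e6]
      field_simp
    rw [Finset.prod_congr rfl h1, Finset.prod_congr rfl h2, prod_range_const_mul,
      Finset.prod_div_distrib, Finset.prod_div_distrib, inv_pow]
    simp only [qPoch]
    field_simp
  have hterm : ∀ i ∈ Finset.range (N + N),
      (∏ l ∈ Finset.range (N + N), ((q ^ 6) ^ i - (q ^ 6) ^ l / q ^ 3)) /
        (∏ l ∈ (Finset.range (N + N)).erase i, ((q ^ 6) ^ i - (q ^ 6) ^ l)) =
      -((q ^ 3) ^ i / q ^ 3) * ((1 - q ^ 3 * (q ^ 6) ^ i) *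
        ((psiProd (q ^ 3) i)⁻¹ * (psiProd (q ^ 3) (N + N - 1 - i))⁻¹)) := by
    intro i hi
    have := partialFraction_weight hx0 hx1 i (N + N - 1 - i)
    rw [show i + 1 + (N + N - 1 - i) = N + N by have := Finset.mem_range.mp hi; omega,
      pow_three_sq] at this
    rw [this, div_eq_mul_inv (1 - _), mul_inv]
  rw [hlhs, Finset.sum_congr rfl fun i hi => by rw [hterm i hi], Finset.sum_range_add,
    ← Finset.sum_range_reflect] at key
  have hA : ∀ k ∈ Finset.range N, -((q ^ 3) ^ (N + k) / q ^ 3) * ((1 - q ^ 3 * (q ^ 6) ^ (N + k)) *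
        ((psiProd (q ^ 3) (N + k))⁻¹ * (psiProd (q ^ 3) (N + N - 1 - (N + k)))⁻¹)) /
          ((q ^ 6) ^ N / q ^ 2 - (q ^ 6) ^ (N + k)) =
      -((q ^ 3) ^ N * q ^ 2)⁻¹ * ((1 - q ^ 3 * (q ^ 6) ^ (N + k)) *
        ((psiProd (q ^ 3) (N + k))⁻¹ * (psiProd (q ^ 3) (N - 1 - k))⁻¹) *
        (q ^ (3 * k + 1) / (1 - q ^ (6 * k + 2)))) := by
    intro k hk
    rw [show N + N - 1 - (N + k) = N - 1 - k by have := Finset.mem_range.mp hk; omega]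
    have e1 : (q ^ 6) ^ N / q ^ 2 - (q ^ 6) ^ (N + k) =
        (q ^ 3) ^ N * (q ^ 3) ^ N / q ^ 2 * (1 - q ^ (6 * k + 2)) := by
      field_simp
      ring
    rw [e1, pow_add (q ^ 3) N k]
    generalize (1 - q ^ 3 * (q ^ 6) ^ (N + k)) *
        ((psiProd (q ^ 3) (N + k))⁻¹ * (psiProd (q ^ 3) (N - 1 - k))⁻¹) = V
    have e2 := hden k 1
    rw [show q ^ (3 * k + 1) = (q ^ 3) ^ k * q by ring]
    generalize (q ^ 3) ^ N = X at *
    generalize q ^ (6 * k + (1 + 1)) = D at *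
    field_simp
  have hB : ∀ k ∈ Finset.range N, -((q ^ 3) ^ (N - 1 - k) / q ^ 3) *
        ((1 - q ^ 3 * (q ^ 6) ^ (N - 1 - k)) *
        ((psiProd (q ^ 3) (N - 1 - k))⁻¹ * (psiProd (q ^ 3) (N + N - 1 - (N - 1 - k)))⁻¹)) /
          ((q ^ 6) ^ N / q ^ 2 - (q ^ 6) ^ (N - 1 - k)) =
      ((q ^ 3) ^ N * q ^ 2)⁻¹ * ((1 - q ^ 3 * (q ^ 6) ^ (N - 1 - k)) *
        ((psiProd (q ^ 3) (N + k))⁻¹ * (psiProd (q ^ 3) (N - 1 - k))⁻¹) *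
        (q ^ (3 * k + 2) / (1 - q ^ (6 * k + 4)))) := by
    intro k hk
    have hk1 := Finset.mem_range.mp hk
    rw [show N + N - 1 - (N - 1 - k) = N + k by omega]
    have hk' : N = (N - 1 - k) + (k + 1) := by omega
    have e0 : (q ^ 3) ^ N = (q ^ 3) ^ (N - 1 - k) * (q ^ 3) ^ (k + 1) := by
      conv_lhs => rw [hk', pow_add]
    have e1 : (q ^ 6) ^ N / q ^ 2 - (q ^ 6) ^ (N - 1 - k) =
        -((q ^ 3) ^ (N - 1 - k) * (q ^ 3) ^ (N - 1 - k) * (1 - q ^ (6 * k + 4))) := by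
      have e3 : (q ^ 6) ^ N = (q ^ 6) ^ (N - 1 - k) * (q ^ 6) ^ (k + 1) := by
        conv_lhs => rw [hk', pow_add]
      rw [e3]
      field_simp
      ring
    rw [e1, e0, mul_comm (psiProd (q ^ 3) (N - 1 - k))⁻¹]
    generalize (1 - q ^ 3 * (q ^ 6) ^ (N - 1 - k)) *
        ((psiProd (q ^ 3) (N + k))⁻¹ * (psiProd (q ^ 3) (N - 1 - k))⁻¹) = V
    have e2 := hden k 3
    have e5 : (q ^ 3) ^ (N - 1 - k) ≠ 0 := pow_ne_zero _ hx0
    have e6 : (q ^ 3) ^ k ≠ 0 := pow_ne_zero _ hx0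
    rw [show q ^ (3 * k + 2) = (q ^ 3) ^ k * q ^ 2 by ring, pow_succ (q ^ 3) k]
    generalize (q ^ 3) ^ (N - 1 - k) = X at *
    generalize (q ^ 3) ^ k = Y at *
    generalize q ^ (6 * k + (3 + 1)) = D at *
    field_simp
  rw [Finset.sum_congr rfl hA, Finset.sum_congr rfl hB, ← Finset.mul_sum, ← Finset.mul_sum] at key
  generalize (∑ k ∈ Finset.range N, _ : ℂ) = S₁ at key ⊢
  generalize (∑ k ∈ Finset.range N, _ : ℂ) = S₂ at key ⊢
  generalize qPoch q⁻¹ (q ^ 6) N * qPoch (q ^ 7) (q ^ 6) N /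
        (qPoch (q ^ 2) (q ^ 6) N * qPoch (q ^ 4) (q ^ 6) N) = Z at key ⊢
  generalize (q ^ 3) ^ N = X at *
  field_simp at key
  linear_combination key

/-- Shifting (1/q;q⁶) and (q⁷;q⁶) to (q⁵;q⁶) and (q;q⁶) costs (1-1/q)/(1-q) = -1/q and factors
tending to 1. What remains, (q,q⁵;q⁶)_N/(q²,q⁴;q⁶)_N, is the N-th product for ψ(q³) over the 3N-th
for ψ(q), after splitting the latter by residues modulo 3. -/
theorem tendsto_theta_quotient {q : ℂ} (h0 : q ≠ 0) (hq : ‖q‖ < 1) :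
    Tendsto (fun N : ℕ => q ^ 2 * (q ^ 3) ^ N - q ^ 2 *
      (qPoch q⁻¹ (q ^ 6) N * qPoch (q ^ 7) (q ^ 6) N /
        (qPoch (q ^ 2) (q ^ 6) N * qPoch (q ^ 4) (q ^ 6) N))) atTop
      (𝓝 (q * (ramanujanPsi (q ^ 3) / ramanujanPsi q))) := by
  have hx1 := norm_cube_lt hq
  have hp1 : ‖q ^ 6‖ < 1 := norm_pow_succ_lt hq 5
  rw [← tendsto_add_atTop_iff_nat 1]
  have hP : Tendsto (fun N : ℕ => psiProd (q ^ 3) N / psiProd q (3 * N)) atTop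
      (𝓝 (ramanujanPsi (q ^ 3) / ramanujanPsi q)) :=
    (tendsto_psiProd hx1).div ((tendsto_psiProd hq).comp
      (tendsto_atTop_mono (fun n => by simp only [id]; omega) tendsto_id)) (ramanujanPsi_ne_zero hq)
  have hpow : ∀ a : ℂ, Tendsto (fun N : ℕ => 1 - a * (q ^ 6) ^ N) atTop (𝓝 1) := fun a => by
    simpa using ((tendsto_pow_atTop_nhds_zero_of_norm_lt_one hp1).const_mul a).const_sub 1
  have hx : Tendsto (fun N : ℕ => q ^ 2 * (q ^ 3) ^ (N + 1)) atTop (𝓝 0) := by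
    simpa using ((tendsto_pow_atTop_nhds_zero_of_norm_lt_one hx1).comp
      (tendsto_add_atTop_nat 1)).const_mul (q ^ 2)
  have hlim := hx.add ((hP.const_mul q).mul (((hpow q).mul (hpow (q ^ 7))).div
    ((hpow (q ^ 2)).mul (hpow (q ^ 4))) (by norm_num)))
  rw [zero_add, mul_one, div_one, mul_one] at hlim
  refine hlim.congr fun N => ?_
  simp only [Pi.div_apply]
  have e1 : qPoch q⁻¹ (q ^ 6) (N + 1) = (1 - q⁻¹) * qPoch (q ^ 5) (q ^ 6) N := by
    rw [qPoch_succ']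
    congr 2
    field_simp
  have e2 : (1 - q) * qPoch (q ^ 7) (q ^ 6) (N + 1) =
      qPoch q (q ^ 6) N * (1 - q * (q ^ 6) ^ N) * (1 - q ^ 7 * (q ^ 6) ^ N) := by
    rw [show q ^ 7 = q * q ^ 6 by ring, ← qPoch_succ', qPoch_succ, qPoch_succ]
    ring
  have e3 : psiProd (q ^ 3) N / psiProd q (3 * N) = qPoch q (q ^ 6) N * qPoch (q ^ 5) (q ^ 6) N /
      (qPoch (q ^ 2) (q ^ 6) N * qPoch (q ^ 4) (q ^ 6) N) := by
    rw [psiProd, psiProd, qPoch_three_mul, qPoch_three_mul, pow_three_sq,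
      show q * q ^ 2 = q ^ 3 by ring, show q * q ^ 4 = q ^ 5 by ring,
      show q ^ 2 * q ^ 2 = q ^ 4 by ring, show q ^ 2 * q ^ 4 = q ^ 6 by ring]
    have f1 := qPoch_ne_zero_of_norm hp1 hp1.le N
    have f2 := qPoch_ne_zero_of_norm hx1 hp1.le N
    have f3 := qPoch_ne_zero_of_norm hq hp1.le N
    have f4 := qPoch_ne_zero_of_norm (norm_pow_succ_lt hq 4) hp1.le N
    have f5 := qPoch_ne_zero_of_norm (norm_pow_succ_lt hq 1) hp1.le N
    have f6 := qPoch_ne_zero_of_norm (norm_pow_succ_lt hq 3) hp1.le N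
    field_simp
  have h1q := one_sub_ne_zero_of_norm hq
  rw [e1, e3, qPoch_succ (q ^ 2), qPoch_succ (q ^ 4)]
  have e4 : qPoch (q ^ 7) (q ^ 6) (N + 1) =
      qPoch q (q ^ 6) N * (1 - q * (q ^ 6) ^ N) * (1 - q ^ 7 * (q ^ 6) ^ N) / (1 - q) := by
    rw [eq_div_iff h1q, ← e2, mul_comm]
  have e5 : 1 - q⁻¹ = -(q⁻¹ * (1 - q)) := by
    field_simp
    ring
  rw [e4, e5]
  generalize qPoch q (q ^ 6) N = A
  generalize qPoch (q ^ 5) (q ^ 6) N = B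
  generalize 1 - q ^ 2 * (q ^ 6) ^ N = D
  generalize 1 - q ^ 4 * (q ^ 6) ^ N = E
  field_simp
  ring

theorem summable_norm_lambert {q : ℂ} (hq : ‖q‖ < 1) (a b : ℕ) :
    Summable fun k : ℕ => ‖q ^ (3 * k + a) / (1 - q ^ (6 * k + (b + 1)))‖ := by
  refine Summable.of_nonneg_of_le (fun _ => norm_nonneg _) (fun k => ?_)
    ((summable_geometric_of_lt_one (norm_nonneg q) hq).mul_right (1 - ‖q‖)⁻¹)
  rw [div_eq_mul_inv, norm_mul, norm_pow]
  have h1 : ‖q‖ ^ (3 * k + a) ≤ ‖q‖ ^ k :=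
    pow_le_pow_of_le_one (norm_nonneg q) hq.le (by omega)
  have h2 := norm_inv_one_sub_pow_le hq (6 * k + b)
  exact mul_le_mul h1 h2 (norm_nonneg _) (by positivity)

/-- In `finite_lambert` every weight tends to ψ(q³)^{-2} and stays bounded, so Tannery's theorem
applies; multiplying by ψ(q³)² produces the cube. -/
theorem lambert_eq_theta {q : ℂ} (h0 : q ≠ 0) (hq : ‖q‖ < 1) :
    (∑' k : ℕ, q ^ (3 * k + 1) / (1 - q ^ (6 * k + 2))) -
      ∑' k : ℕ, q ^ (3 * k + 2) / (1 - q ^ (6 * k + 4)) =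
      q * (ramanujanPsi (q ^ 3) ^ 3 / ramanujanPsi q) := by
  have hx1 := norm_cube_lt hq
  have hp1 : ‖q ^ 6‖ < 1 := norm_pow_succ_lt hq 5
  obtain ⟨C, hC, hb⟩ := exists_norm_psiProd_le hx1
  have hψ := ramanujanPsi_ne_zero hx1
  have hR : Tendsto (fun n => (psiProd (q ^ 3) n)⁻¹) atTop (𝓝 (ramanujanPsi (q ^ 3))⁻¹) :=
    (tendsto_psiProd hx1).inv₀ hψ
  have hu : ∀ k : ℕ, Tendsto (fun N : ℕ => N + k) atTop atTop := fun k => tendsto_add_atTop_nat k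
  have hd : ∀ k : ℕ, Tendsto (fun N : ℕ => N - 1 - k) atTop atTop := fun k =>
    (tendsto_sub_atTop_nat k).comp (tendsto_sub_atTop_nat 1)
  have hpow : Tendsto (fun N : ℕ => 1 - q ^ 3 * (q ^ 6) ^ N) atTop (𝓝 1) := by
    simpa using ((tendsto_pow_atTop_nhds_zero_of_norm_lt_one hp1).const_mul (q ^ 3)).const_sub 1
  have hpb : ∀ N : ℕ, ‖1 - q ^ 3 * (q ^ 6) ^ N‖ ≤ 2 := fun N => by
    refine (norm_sub_le _ _).trans ?_
    have := norm_mul_pow_lt hx1 hp1.le N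
    rw [norm_one]
    linarith
  have hbound : ∀ i j l : ℕ, ‖(1 - q ^ 3 * (q ^ 6) ^ i) *
      ((psiProd (q ^ 3) j)⁻¹ * (psiProd (q ^ 3) l)⁻¹)‖ ≤ 2 * (C * C) := fun i j l => by
    rw [norm_mul, norm_mul]
    have h1 := hpb i
    have h2 := (hb j).2
    have h3 := (hb l).2
    gcongr
  have t1 := tendsto_sum_mul_of_bounded (W := 1 * ((ramanujanPsi (q ^ 3))⁻¹ *
      (ramanujanPsi (q ^ 3))⁻¹)) (summable_norm_lambert hq 1 1)
    (w := fun N k => (1 - q ^ 3 * (q ^ 6) ^ (N + k)) *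
        ((psiProd (q ^ 3) (N + k))⁻¹ * (psiProd (q ^ 3) (N - 1 - k))⁻¹))
    (fun N k _ => hbound _ _ _)
    (fun k => (hpow.comp (hu k)).mul ((hR.comp (hu k)).mul (hR.comp (hd k))))
  have t2 := tendsto_sum_mul_of_bounded (W := 1 * ((ramanujanPsi (q ^ 3))⁻¹ *
      (ramanujanPsi (q ^ 3))⁻¹)) (summable_norm_lambert hq 2 3)
    (w := fun N k => (1 - q ^ 3 * (q ^ 6) ^ (N - 1 - k)) *
        ((psiProd (q ^ 3) (N + k))⁻¹ * (psiProd (q ^ 3) (N - 1 - k))⁻¹))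
    (fun N k _ => hbound _ _ _)
    (fun k => (hpow.comp (hd k)).mul ((hR.comp (hu k)).mul (hR.comp (hd k))))
  have t3 := (t1.sub t2).congr fun N => finite_lambert h0 hq N
  have h := tendsto_nhds_unique t3 (tendsto_theta_quotient h0 hq)
  rw [← mul_sub, one_mul] at h
  have hψq := ramanujanPsi_ne_zero hq
  field_simp at h ⊢
  linear_combination h

theorem lambertTerm_sub_eq_theta {q : ℂ} (hq : ‖q‖ < 1) :
    ∑' n, lambertTerm (q ^ 3) (q ^ 2) n - ∑' n, lambertTerm (q ^ 3) q n =
      q * (ramanujanPsi (q ^ 3) ^ 3 / ramanujanPsi q) := by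
  -- The partial fractions need q ≠ 0; at q = 0 both sides vanish.
  rcases eq_or_ne q 0 with rfl | h0
  · simp [lambertTerm]
  · rw [← lambert_eq_theta h0 hq]
    have t1 := tendsto_sum_lambert (norm_cube_lt hq) (norm_pow_succ_lt hq 1)
    have t2 := tendsto_sum_lambert (norm_cube_lt hq) hq
    have s1 := ((summable_norm_lambert hq 1 1).of_norm).hasSum.tendsto_sum_nat
    have s2 := ((summable_norm_lambert hq 2 3).of_norm).hasSum.tendsto_sum_nat
    have r1 := tendsto_nhds_unique t1 (s2.neg.congr fun K => by
      rw [← Finset.sum_neg_distrib]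
      refine Finset.sum_congr rfl fun k _ => ?_
      rw [← neg_div]
      congr 2 <;> ring)
    have r2 := tendsto_nhds_unique t2 (s1.neg.congr fun K => by
      rw [← Finset.sum_neg_distrib]
      refine Finset.sum_congr rfl fun k _ => ?_
      rw [← neg_div]
      congr 2 <;> ring)
    rw [r1, r2]
    ring

/-! ### A q-Gauss sum. -/

/-- The general term of
`∑_m (p^{2j}; p^2)_m (-c)^m / ((p; p)_m (c; p)_{2j+m})`. -/
noncomputable def gaussTerm (p : ℂ) (j : ℕ) (c : ℂ) (m : ℕ) : ℂ :=
  qPoch (p ^ (2 * j)) (p ^ 2) m * (-c) ^ m * ((qPoch p p m)⁻¹ * (qPoch c p (2 * j + m))⁻¹)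

theorem exists_norm_gaussTerm_le {p : ℂ} {r : ℝ} (hp : ‖p‖ < 1) (hr1 : r < 1) :
    ∃ C : ℝ, ∀ (j : ℕ) (x : ℂ) (m : ℕ), ‖x‖ ≤ r → ‖gaussTerm p j x m‖ ≤ C * ‖x‖ ^ m := by
  refine ⟨Real.exp (1 / (1 - ‖p ^ 2‖)) * (Real.exp (‖p‖ / (1 - ‖p‖) / (1 - ‖p‖)) *
    Real.exp (r / (1 - r) / (1 - ‖p‖))), fun j x m hx => ?_⟩
  have h1 := norm_qPoch_le (a := p ^ (2 * j)) (s := 1)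
    (by rw [norm_pow]; exact pow_le_one₀ (norm_nonneg p) hp.le) (norm_sq_lt hp) m
  have h2 := norm_inv_qPoch_le (le_refl ‖p‖) hp hp m
  have h3 := norm_inv_qPoch_le hx hr1 hp (2 * j + m)
  rw [gaussTerm, norm_mul, norm_mul, norm_mul, norm_pow, norm_neg]
  calc _ ≤ Real.exp (1 / (1 - ‖p ^ 2‖)) * ‖x‖ ^ m * (Real.exp (‖p‖ / (1 - ‖p‖) / (1 - ‖p‖)) *
        Real.exp (r / (1 - r) / (1 - ‖p‖))) := by gcongr
    _ = _ := by ring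

theorem summable_gaussTerm {p c : ℂ} (hp : ‖p‖ < 1) (hc : ‖c‖ < 1) (j : ℕ) :
    Summable (gaussTerm p j c) := by
  obtain ⟨C, hC⟩ := exists_norm_gaussTerm_le hp hc
  exact Summable.of_norm_bounded ((summable_geometric_of_lt_one (norm_nonneg c) hc).mul_left C)
    fun m => hC j c m le_rfl

theorem tsum_gaussTerm_functional {p c : ℂ} (hp : ‖p‖ < 1) (hc : ‖c‖ < 1) (j : ℕ) :
    (1 - c ^ 2) * ∑' m, gaussTerm p j c m =
      (1 - c ^ 2 * p ^ (2 * j)) * ∑' m, gaussTerm p j (c * p) m := by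
  have hcp : ‖c * p‖ < 1 := by simpa using norm_mul_pow_lt hc hp.le 1
  rw [← tsum_mul_left, ← tsum_mul_left]
  -- The factor 1 - p^m kills the boundary value at m = 0, so the functional equation is
  -- homogeneous.
  have key := tsum_eq_of_telescope (t := fun m => (1 - c ^ 2) * gaussTerm p j c m)
    (s := fun m => (1 - c ^ 2 * p ^ (2 * j)) * gaussTerm p j (c * p) m)
    (U := fun m => (1 - c) * (1 - p ^ m) * gaussTerm p j c m)
    ((summable_gaussTerm hp hc j).mul_left _) ((summable_gaussTerm hp hcp j).mul_left _) ?_ ?_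
  · rw [key]
    simp
  · intro m
    have f1 : 1 - p ^ (m + 1) ≠ 0 := one_sub_ne_zero_of_norm (norm_pow_succ_lt hp m)
    have f3 := qPoch_ne_zero_of_norm hcp hp.le (2 * j + m)
    have f4 : 1 - c * p ^ (2 * j + m) ≠ 0 := one_sub_ne_zero_of_norm (norm_mul_pow_lt hc hp.le _)
    have f5 : qPoch c p (2 * j + m) =
        (1 - c) * qPoch (c * p) p (2 * j + m) / (1 - c * p ^ (2 * j + m)) := by
      rw [← qPoch_succ', qPoch_succ c p]
      field_simp
    have f6 := qPoch_ne_zero_of_norm hp hp.le m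
    have f7 := one_sub_ne_zero_of_norm hc
    simp only [gaussTerm]
    rw [← add_assoc, qPoch_succ' c p (2 * j + m), f5, qPoch_succ _ _ m, qPoch_succ _ _ m,
      pow_succ (-c), show p * p ^ m = p ^ (m + 1) by ring,
      show (-(c * p)) ^ m = (-c) ^ m * p ^ m by rw [← mul_pow]; ring,
      show p ^ (2 * j) * (p ^ 2) ^ m = p ^ (2 * j) * p ^ m * p ^ m by ring, pow_add p (2 * j) m] at *
    generalize qPoch (c * p) p (2 * j + m) = A at *
    generalize qPoch (p ^ (2 * j)) (p ^ 2) m = B at *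
    generalize qPoch p p m = D at *
    generalize (-c) ^ m = z at *
    generalize p ^ (m + 1) = y' at *
    generalize p ^ m = y at *
    generalize p ^ (2 * j) = w at *
    field_simp
    ring
  · have h1 := (summable_gaussTerm hp hc j).tendsto_atTop_zero.const_mul (1 - c)
    have h2 := (tendsto_pow_atTop_nhds_zero_of_norm_lt_one hp).const_sub 1
    have h3 := h2.mul h1
    simp only [mul_zero] at h3
    exact h3.congr fun m => by ring

theorem tendsto_qPoch_mul_pow {p : ℂ} (c : ℂ) (hp : ‖p‖ < 1) (n : ℕ) :
    Tendsto (fun k : ℕ => qPoch (c * p ^ k) p n) atTop (𝓝 1) := by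
  have h : Tendsto (fun k : ℕ => c * p ^ k) atTop (𝓝 0) := by
    simpa using (tendsto_pow_atTop_nhds_zero_of_norm_lt_one hp).const_mul c
  have h2 : Continuous fun x : ℂ => qPoch x p n := by
    unfold qPoch
    fun_prop
  have h3 := (h2.tendsto 0).comp h
  simpa [qPoch, Function.comp_def] using h3

/-- A `q`-Gauss sum. -/
theorem tsum_gaussTerm {p c : ℂ} (hp : ‖p‖ < 1) (hc : ‖c‖ < 1) (j : ℕ) :
    qPoch (c ^ 2) (p ^ 2) j * ∑' m, gaussTerm p j c m = 1 := by
  -- The product is invariant under x ↦ xp, hence equal to its limit along c p^k → 0, where only the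
  -- term m = 0 survives and equals 1.
  have hstep : ∀ x : ℂ, ‖x‖ < 1 → qPoch (x ^ 2) (p ^ 2) j * ∑' m, gaussTerm p j x m =
      qPoch ((x * p) ^ 2) (p ^ 2) j * ∑' m, gaussTerm p j (x * p) m := by
    intro x hx
    have hx2 : 1 - x ^ 2 ≠ 0 := one_sub_ne_zero_of_norm (norm_pow_succ_lt hx 1)
    have h1 := tsum_gaussTerm_functional hp hx j
    have h2 := qPoch_succ' (x ^ 2) (p ^ 2) j
    rw [qPoch_succ, ← pow_mul, ← mul_pow] at h2
    refine mul_left_cancel₀ hx2 ?_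
    rw [mul_left_comm, h1, ← mul_assoc (1 - x ^ 2), ← h2]
    ring
  have hconst : ∀ k : ℕ, qPoch (c ^ 2) (p ^ 2) j * ∑' m, gaussTerm p j c m =
      qPoch ((c * p ^ k) ^ 2) (p ^ 2) j * ∑' m, gaussTerm p j (c * p ^ k) m := by
    intro k
    induction k with
    | zero => simp
    | succ k ih => rw [ih, hstep _ (norm_mul_pow_lt hc hp.le k), mul_assoc c, ← pow_succ]
  obtain ⟨C, hC⟩ := exists_norm_gaussTerm_le hp hc
  have h0 := tendsto_tsum_mul_pow_zero (t := fun x n => gaussTerm p j x (n + 1)) (C := C) hc hp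
    fun x n hx => hC j x (n + 1) hx
  have h1 : Tendsto (fun k : ℕ => ∑' m, gaussTerm p j (c * p ^ k) m) atTop (𝓝 1) := by
    have h2 : ∀ k : ℕ, ∑' m, gaussTerm p j (c * p ^ k) m =
        (qPoch (c * p ^ k) p (2 * j))⁻¹ + ∑' m, gaussTerm p j (c * p ^ k) (m + 1) := fun k => by
      rw [(summable_gaussTerm hp (norm_mul_pow_lt hc hp.le k) j).tsum_eq_zero_add]
      simp [gaussTerm, qPoch]
    simp only [h2]
    simpa using ((tendsto_qPoch_mul_pow c hp (2 * j)).inv₀ one_ne_zero).add h0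
  have h3 : Tendsto (fun k : ℕ => qPoch ((c * p ^ k) ^ 2) (p ^ 2) j) atTop (𝓝 1) :=
    (tendsto_qPoch_mul_pow (c ^ 2) (norm_sq_lt hp) j).congr fun k => by
      congr 1
      ring
  have h4 := (h3.mul h1).congr fun k => (hconst k).symm
  rw [one_mul] at h4
  exact tendsto_nhds_unique tendsto_const_nhds h4

/-! ### A limiting case of Bailey's lemma. -/

/-- The convolution of a null sequence with a geometric sequence is a null sequence. -/
theorem tendsto_sum_mul_geometric {x : ℕ → ℝ} {r : ℝ} (hr : 0 ≤ r) (hr1 : r < 1)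
    (hx0 : ∀ n, 0 ≤ x n) (hx : Tendsto x atTop (𝓝 0)) :
    Tendsto (fun N : ℕ => ∑ j ∈ Finset.range N, x j * r ^ (N - j)) atTop (𝓝 0) := by
  obtain ⟨B, hB⟩ := hx.bddAbove_range
  have h1 : ∀ N : ℕ, ∑ j ∈ Finset.range N, x j * r ^ (N - j) =
      ∑' i : ℕ, if i < N then x (N - 1 - i) * r ^ (i + 1) else 0 := by
    intro N
    rw [tsum_eq_sum (s := Finset.range N) fun k hk => if_neg (by simpa using hk),
      ← Finset.sum_range_reflect]
    refine Finset.sum_congr rfl fun k hk => ?_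
    have hk' := Finset.mem_range.mp hk
    rw [if_pos hk', show N - (N - 1 - k) = k + 1 by omega]
  simp only [h1]
  suffices h : Tendsto _ atTop (𝓝 (∑' _ : ℕ, (0 : ℝ))) by rwa [tsum_zero] at h
  refine tendsto_tsum_of_dominated_convergence (bound := fun i => |B| * r ^ i)
    ((summable_geometric_of_lt_one hr hr1).mul_left _) (fun i => ?_)
    (Eventually.of_forall fun N i => ?_)
  · have h2 : Tendsto (fun N : ℕ => x (N - 1 - i) * r ^ (i + 1)) atTop (𝓝 0) := by
      simpa using (hx.comp ((tendsto_sub_atTop_nat i).comp (tendsto_sub_atTop_nat 1))).mul_const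
        (r ^ (i + 1))
    refine h2.congr' ?_
    filter_upwards [eventually_gt_atTop i] with N hN
    rw [if_pos hN]
  · split_ifs with h
    · rw [Real.norm_eq_abs, abs_of_nonneg (by have := hx0 (N - 1 - i); positivity)]
      have h3 : x (N - 1 - i) ≤ |B| := (hB ⟨_, rfl⟩).trans (le_abs_self B)
      have h4 : r ^ (i + 1) ≤ r ^ i := pow_le_pow_of_le_one hr hr1.le (by omega)
      gcongr
    · rw [norm_zero]
      positivity

/-- A summation method whose rows are geometrically dominated and have sum one sums every
convergent series to its sum. -/
theorem tendsto_sum_convolution {y : ℕ → ℂ} {g : ℕ → ℕ → ℂ} {A : ℂ} {K r : ℝ} (hr : 0 ≤ r)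
    (hr1 : r < 1) (hg : ∀ j m, ‖g j m‖ ≤ K * r ^ m) (hg1 : ∀ j, ∑' m, g j m = 1)
    (hy : Tendsto (fun N : ℕ => ∑ j ∈ Finset.range N, y j) atTop (𝓝 A)) :
    Tendsto (fun N : ℕ => ∑ n ∈ Finset.range N, ∑ j ∈ Finset.range (n + 1), y j * g j (n - j))
      atTop (𝓝 A) := by
  have hgeo := summable_geometric_of_lt_one hr hr1
  have hgs : ∀ j, Summable (g j) := fun j => Summable.of_norm_bounded (hgeo.mul_left K) (hg j)
  have hy0 : Tendsto y atTop (𝓝 0) := by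
    have h1 := (hy.comp (tendsto_add_atTop_nat 1)).sub hy
    rw [sub_self] at h1
    refine h1.congr fun N => ?_
    simp [Finset.sum_range_succ]
  have htail : ∀ j M, ‖∑' m, g j (m + M)‖ ≤ K * (1 - r)⁻¹ * r ^ M := by
    intro j M
    have h1 : HasSum (fun m : ℕ => K * r ^ M * r ^ m) (K * r ^ M * (1 - r)⁻¹) :=
      (hasSum_geometric_of_lt_one hr hr1).mul_left _
    refine (tsum_of_norm_bounded h1 fun m => ?_).trans (le_of_eq (by ring))
    refine (hg j (m + M)).trans (le_of_eq ?_)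
    rw [pow_add]
    ring
  -- Exchanging sums over the finite triangle requires no absolute convergence of `y`. Each row sums
  -- to 1, so what is missing from row j is its tail beyond N-j, of size O(r^{N-j}).
  have hflip : ∀ N : ℕ, ∑ n ∈ Finset.range N, ∑ j ∈ Finset.range (n + 1), y j * g j (n - j) =
      (∑ j ∈ Finset.range N, y j) - ∑ j ∈ Finset.range N, y j * ∑' m, g j (m + (N - j)) := by
    intro N
    rw [Finset.sum_range_diag_flip N fun j m => y j * g j m, ← Finset.sum_sub_distrib]
    refine Finset.sum_congr rfl fun j _ => ?_
    have h1 := (hgs j).sum_add_tsum_nat_add (N - j)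
    rw [hg1 j] at h1
    rw [← Finset.mul_sum, eq_sub_of_add_eq h1]
    ring
  have hzero : Tendsto (fun N : ℕ => ∑ j ∈ Finset.range N, y j * ∑' m, g j (m + (N - j))) atTop
      (𝓝 0) := by
    have h1 := (tendsto_sum_mul_geometric hr hr1 (fun n => norm_nonneg (y n))
      (by simpa using hy0.norm)).const_mul (K * (1 - r)⁻¹)
    rw [mul_zero] at h1
    refine squeeze_zero_norm (fun N => ?_) h1
    rw [Finset.mul_sum]
    refine (norm_sum_le _ _).trans (Finset.sum_le_sum fun j _ => ?_)
    rw [norm_mul]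
    calc ‖y j‖ * ‖∑' m, g j (m + (N - j))‖ ≤ ‖y j‖ * (K * (1 - r)⁻¹ * r ^ (N - j)) := by
          gcongr
          exact htail j (N - j)
      _ = _ := by ring
  simp only [hflip]
  simpa using hy.sub hzero

/-- The limiting case `ρ₁ → 1`, `ρ₂ = -1` of Bailey's lemma. -/
theorem IsBaileyPair.seriesSum {a p c : ℂ} {α β : ℕ → ℂ} (h : IsBaileyPair a p α β)
    (hp : ‖p‖ < 1) (hac : a * p = c) (hc : ‖c‖ < 1) {A : ℂ}
    (hA : SeriesSum (fun n => qPoch (p ^ 2) (p ^ 2) (n - 1) * (-c) ^ n / qPoch (c ^ 2) (p ^ 2) n *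
      α n) A) :
    SeriesSum (fun n => qPoch (p ^ 2) (p ^ 2) (n - 1) * (-c) ^ n * β n)
      (A + ∑' n, lambertTerm p c n) := by
  rw [seriesSum_iff] at hA ⊢
  have hp2 := norm_sq_lt hp
  have hc2 : ‖c ^ 2‖ < 1 := norm_pow_succ_lt hc 1
  obtain ⟨C, hC⟩ := exists_norm_gaussTerm_le hp hc
  set E := Real.exp (1 / (1 - ‖p ^ 2‖))
  -- The weight is the ratio between the coefficient of α_{j+1} inside the β-series and its
  -- coefficient in the α-series; its sum over m is 1 by the q-Gauss sum.
  have hconv := tendsto_sum_convolution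
    (g := fun j m => qPoch (c ^ 2) (p ^ 2) (j + 1) * gaussTerm p (j + 1) c m)
    (K := E * C) (norm_nonneg c) hc (fun j m => by
      rw [norm_mul, mul_assoc]
      exact mul_le_mul (norm_qPoch_le hc2.le hp2 _) (hC _ _ _ le_rfl) (norm_nonneg _)
        (Real.exp_pos _).le)
    (fun j => by rw [tsum_mul_left, tsum_gaussTerm hp hc]) hA
  have hl := (summable_lambertTerm hp hc).hasSum.tendsto_sum_nat
  refine (hconv.add hl).congr fun N => ?_
  rw [← Finset.sum_add_distrib]
  refine Finset.sum_congr rfl fun n _ => ?_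
  -- The index j = 0 is absent from the α-series and is split off. Since (p²;p²)_n = (p;p)_n
  -- (-p;p)_n, it contributes exactly `lambertTerm`.
  rw [h.beta_eq (n + 1) n.succ_pos, Finset.sum_range_succ' _ (n + 1), mul_add, Finset.mul_sum, hac,
    h.alpha_zero]
  congr 1
  · refine Finset.sum_congr rfl fun j hj => ?_
    obtain ⟨m, rfl⟩ := Nat.exists_eq_add_of_le (Nat.lt_succ_iff.mp (Finset.mem_range.mp hj))
    have e1 := qPoch_ne_zero_of_norm hc2 hp2.le (j + 1)
    have e2 : p ^ 2 * (p ^ 2) ^ j = p ^ (2 * (j + 1)) := by ring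
    rw [show j + m - j = m by omega, show j + m + 1 - (j + 1) = m by omega, gaussTerm,
      show j + m + 1 + (j + 1) = 2 * (j + 1) + m by ring, Nat.add_sub_cancel, Nat.add_sub_cancel,
      qPoch_add (p ^ 2) _ j m, e2, show j + m + 1 = j + 1 + m by ring, pow_add (-c) (j + 1) m]
    field_simp
  · have e1 := qPoch_ne_zero_of_norm hp hp.le n
    rw [lambertTerm, Nat.sub_zero, add_zero, Nat.add_sub_cancel, ← qPoch_mul_neg, qPoch_succ p p n,
      ← pow_succ']
    field_simp

/-! ### A Bailey pair with α supported on even indices. -/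

/-- `1 / (p; p)_{n - k}`, read as zero when `n < k`. -/
noncomputable def invPoch (p : ℂ) (n k : ℕ) : ℂ :=
  if k ≤ n then (qPoch p p (n - k))⁻¹ else 0

/-- The zero convention makes the recurrence unconditional: at the boundary k = n+1 the linear
factor itself vanishes. -/
theorem invPoch_eq_mul_succ_left {p : ℂ} (h0 : p ≠ 0) (hp : ‖p‖ < 1) (n k : ℕ) :
    invPoch p n k = (1 - p ^ (n + 1) / p ^ k) * invPoch p (n + 1) k := by
  rcases lt_trichotomy k (n + 1) with h | h | h
  · obtain ⟨m, rfl⟩ := Nat.exists_eq_add_of_le (Nat.lt_succ_iff.mp h)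
    have e1 : 1 - p * p ^ m ≠ 0 := one_sub_ne_zero_of_norm (norm_mul_pow_lt hp hp.le m)
    rw [invPoch, invPoch, if_pos (by omega), if_pos (by omega), show k + m - k = m by omega,
      show k + m + 1 - k = m + 1 by omega, qPoch_succ, add_assoc, pow_add p k, pow_succ' p m]
    field_simp
  · subst h
    rw [invPoch, if_neg (by omega), div_self (pow_ne_zero _ h0)]
    ring
  · rw [invPoch, invPoch, if_neg (by omega), if_neg (by omega), mul_zero]

theorem invPoch_succ_right {p : ℂ} (h0 : p ≠ 0) (hp : ‖p‖ < 1) (n k : ℕ) :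
    invPoch p n (k + 1) = (1 - p ^ n / p ^ k) * invPoch p n k := by
  rcases lt_trichotomy k n with h | h | h
  · obtain ⟨m, rfl⟩ := Nat.exists_eq_add_of_le (Nat.succ_le_of_lt h)
    have e1 : 1 - p * p ^ m ≠ 0 := one_sub_ne_zero_of_norm (norm_mul_pow_lt hp hp.le m)
    rw [invPoch, invPoch, if_pos (by omega), if_pos (by omega),
      show k.succ + m - (k + 1) = m by omega, show k.succ + m - k = m + 1 by omega, qPoch_succ,
      show k.succ + m = k + (m + 1) by omega, pow_add p k, pow_succ' p m]
    field_simp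
  · subst h
    rw [invPoch, if_neg (by omega), div_self (pow_ne_zero _ h0)]
    ring
  · rw [invPoch, invPoch, if_neg (by omega), if_neg (by omega), mul_zero]

/-- The even-indexed terms of the sequence `α` of a Bailey pair with a free parameter `e`. -/
noncomputable def evenAlpha (a p e : ℂ) (j : ℕ) : ℂ :=
  (1 - a * p ^ (4 * j)) / (1 - a) *
    (qPoch a (p ^ 2) j / (qPoch (p ^ 2) (p ^ 2) j * qPoch (a * p ^ 2 * e) (p ^ 2) j)) *
    (a ^ j * p ^ (2 * j ^ 2)) * ∏ i ∈ Finset.range j, (e - (p ^ 2) ^ i)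

/-- The sequence `β` of the Bailey pair of `evenAlpha`. -/
noncomputable def quadraticBeta (a p e : ℂ) (n : ℕ) : ℂ :=
  qPoch (a * p * e) (p ^ 2) n /
    (qPoch (a * p) (p ^ 2) n * (qPoch (a * p * e) p n * qPoch p p n))

theorem evenAlpha_zero {a : ℂ} (p e : ℂ) (ha : a ≠ 1) : evenAlpha a p e 0 = 1 := by
  have : 1 - a ≠ 0 := sub_ne_zero.mpr ha.symm
  simp [evenAlpha, qPoch, this]

theorem evenAlpha_succ {a p : ℂ} (e : ℂ) (ha : ∀ k : ℕ, a * p ^ k ≠ 1) (j : ℕ) :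
    evenAlpha a p e (j + 1) = evenAlpha a p e j *
      ((1 - a * (p ^ (2 * j)) ^ 2 * p ^ 4) / (1 - a * (p ^ (2 * j)) ^ 2) *
        ((1 - a * p ^ (2 * j)) * (e - p ^ (2 * j)) /
          ((1 - p ^ 2 * p ^ (2 * j)) * (1 - a * p ^ 2 * e * p ^ (2 * j)))) *
        (a * p ^ 2 * (p ^ (2 * j)) ^ 2)) := by
  have h1 : 1 - a * (p ^ (2 * j)) ^ 2 ≠ 0 := by
    rw [← pow_mul]
    exact sub_ne_zero.mpr (ha _).symm
  have e1 : p ^ (2 * (j + 1) ^ 2) = p ^ (2 * j ^ 2) * (p ^ 2 * (p ^ (2 * j)) ^ 2) := by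
    rw [← pow_mul, ← pow_add, ← pow_add]
    congr 1
    ring
  have e2 : p ^ (4 * (j + 1)) = (p ^ (2 * j)) ^ 2 * p ^ 4 := by
    rw [← pow_mul, ← pow_add]
    congr 1
    ring
  have e3 : p ^ (4 * j) = (p ^ (2 * j)) ^ 2 := by
    rw [← pow_mul]
    congr 1
    ring
  simp only [evenAlpha, qPoch_succ, Finset.prod_range_succ]
  rw [pow_succ a j, e1, e2, e3, ← pow_mul p 2 j]
  clear e1 e2 e3 ha
  generalize p ^ (2 * j) = Z at *
  generalize qPoch a (p ^ 2) j = A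
  generalize qPoch (p ^ 2) (p ^ 2) j = B
  generalize qPoch (a * p ^ 2 * e) (p ^ 2) j = D
  generalize ∏ i ∈ Finset.range j, (e - (p ^ 2) ^ i) = E
  generalize p ^ (2 * j ^ 2) = T
  rw [← mul_assoc a (Z ^ 2)]
  generalize 1 - p ^ 2 * Z = F
  generalize 1 - a * p ^ 2 * e * Z = G
  generalize 1 - a * Z ^ 2 * p ^ 4 = H
  generalize 1 - a * Z ^ 2 = K at *
  generalize 1 - a * Z = K'
  generalize 1 - a = K''
  generalize e - Z = K'''
  generalize a ^ j = W
  refine (mul_one _).symm.trans ?_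
  rw [← mul_inv_cancel₀ h1]
  ring

theorem quadraticBeta_succ {a p e : ℂ} (hp : ‖p‖ < 1) (ha : ∀ k : ℕ, a * p ^ k ≠ 1)
    (he : ∀ k : ℕ, a * p * e * p ^ k ≠ 1) (n : ℕ) :
    (1 - a * p * (p ^ n) ^ 2) * (1 - a * p * e * p ^ n) * (1 - p * p ^ n) *
      quadraticBeta a p e (n + 1) = (1 - a * p * e * (p ^ n) ^ 2) * quadraticBeta a p e n := by
  have h1 : 1 - p * p ^ n ≠ 0 := one_sub_ne_zero_of_norm (norm_mul_pow_lt hp hp.le n)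
  have h2 : 1 - a * p * (p ^ n) ^ 2 ≠ 0 := by
    rw [show a * p * (p ^ n) ^ 2 = a * p ^ (2 * n + 1) by ring]
    exact sub_ne_zero.mpr (ha _).symm
  have h3 : 1 - a * p * e * p ^ n ≠ 0 := sub_ne_zero.mpr (he n).symm
  simp only [quadraticBeta, qPoch_succ, show (p ^ 2) ^ n = (p ^ n) ^ 2 by ring]
  generalize 1 - p * p ^ n = F at *
  generalize 1 - a * p * e * p ^ n = G at *
  generalize 1 - a * p * (p ^ n) ^ 2 = H at *
  field_simp

/-- Both sides satisfy the first-order recurrence in n of `quadraticBeta_succ`. Any `J` beyond n/2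
is allowed, so the same range serves n and n+1 in the induction. -/
theorem sum_evenAlpha_eq {a p e : ℂ} (h0 : p ≠ 0) (hp : ‖p‖ < 1) (ha : ∀ k : ℕ, a * p ^ k ≠ 1)
    (he : ∀ k : ℕ, a * p * e * p ^ k ≠ 1) (n J : ℕ) (hJ : n < 2 * J) :
    ∑ j ∈ Finset.range J, evenAlpha a p e j * invPoch p n (2 * j) *
      (qPoch (a * p) p (n + 2 * j))⁻¹ = quadraticBeta a p e n := by
  have hap : ∀ k : ℕ, a * p * p ^ k ≠ 1 := fun k => by
    rw [mul_assoc, ← pow_succ']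
    exact ha _
  induction n with
  | zero =>
    obtain ⟨J, rfl⟩ : ∃ K, J = K + 1 := ⟨J - 1, by omega⟩
    rw [Finset.sum_range_succ', Finset.sum_eq_zero fun j _ => by
      rw [invPoch, if_neg (by omega), mul_zero, zero_mul]]
    simp [evenAlpha_zero p e (by simpa using ha 0 : a ≠ 1), invPoch, quadraticBeta, qPoch]
  | succ n ih =>
    set Y := p ^ n with hY
    -- The q-Zeilberger certificate: the summand for n+1 times a rational function of p^{2j} and
    -- p^n. It vanishes at j = 0 through 1 - p^{2j}, and at j = J because 2J > n+1 makes `invPoch`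
    -- zero.
    set G : ℕ → ℂ := fun j => -(p * Y) * ((1 - p ^ (2 * j)) * (1 - a * e * p ^ (2 * j)) /
      (p ^ (2 * j) * (1 - a * (p ^ (2 * j)) ^ 2))) * (evenAlpha a p e j * invPoch p (n + 1) (2 * j)) *
      ((1 - a * Y * p ^ (2 * j) * p) * (1 - a * Y * p ^ (2 * j)) *
        (qPoch (a * p) p (n + 1 + 2 * j))⁻¹) with hG
    have hstep : ∀ j, (1 - a * p * Y ^ 2) * (1 - a * p * e * Y) * (1 - p * Y) *
          (evenAlpha a p e j * invPoch p (n + 1) (2 * j) * (qPoch (a * p) p (n + 1 + 2 * j))⁻¹) =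
        (1 - a * p * e * Y ^ 2) *
          (evenAlpha a p e j * invPoch p n (2 * j) * (qPoch (a * p) p (n + 2 * j))⁻¹) +
        (G (j + 1) - G j) := by
      intro j
      have hQ := qPoch_ne_zero hap (n + 2 * j)
      have hq1 : ∀ k, 1 - a * p * (Y * p ^ (2 * j) * p ^ k) ≠ 0 := fun k => by
        rw [hY, ← pow_add, ← pow_add]
        exact sub_ne_zero.mpr (hap _).symm
      have e1 : qPoch (a * p) p (n + 1 + 2 * j) =
          qPoch (a * p) p (n + 2 * j) * (1 - a * p * (Y * p ^ (2 * j) * p ^ 0)) := by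
        rw [show n + 1 + 2 * j = n + 2 * j + 1 by ring, qPoch_succ, hY]
        ring
      have e2 : qPoch (a * p) p (n + 1 + 2 * (j + 1)) =
          qPoch (a * p) p (n + 2 * j) * (1 - a * p * (Y * p ^ (2 * j) * p ^ 0)) *
            (1 - a * p * (Y * p ^ (2 * j) * p ^ 1)) * (1 - a * p * (Y * p ^ (2 * j) * p ^ 2)) := by
        rw [show n + 1 + 2 * (j + 1) = n + 2 * j + 1 + 1 + 1 by ring, qPoch_succ, qPoch_succ,
          qPoch_succ, hY]
        ring
      have e3 : invPoch p (n + 1) (2 * (j + 1)) = (1 - Y / p ^ (2 * j)) *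
          ((1 - p * Y / p ^ (2 * j)) * invPoch p (n + 1) (2 * j)) := by
        rw [show 2 * (j + 1) = 2 * j + 1 + 1 by ring, invPoch_succ_right h0 hp,
          invPoch_succ_right h0 hp, hY, pow_succ p n, pow_succ p (2 * j)]
        have : p ^ (2 * j) ≠ 0 := pow_ne_zero _ h0
        field_simp
      have e4 : invPoch p n (2 * j) = (1 - p * Y / p ^ (2 * j)) * invPoch p (n + 1) (2 * j) := by
        rw [invPoch_eq_mul_succ_left h0 hp, hY, pow_succ' p n]
      have h3 : p ^ (2 * j) ≠ 0 := pow_ne_zero _ h0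
      have h4 : 1 - a * (p ^ (2 * j)) ^ 2 ≠ 0 := by
        rw [← pow_mul]
        exact sub_ne_zero.mpr (ha _).symm
      have h5 : 1 - a * (p ^ (2 * j)) ^ 2 * p ^ 4 ≠ 0 := by
        rw [← pow_mul, mul_assoc, ← pow_add]
        exact sub_ne_zero.mpr (ha _).symm
      have h6 : 1 - p ^ 2 * p ^ (2 * j) ≠ 0 := by
        rw [← pow_add]
        exact one_sub_ne_zero_of_norm (by rw [add_comm]; exact norm_pow_succ_lt hp _)
      have h7 : 1 - a * p ^ 2 * e * p ^ (2 * j) ≠ 0 := by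
        rw [show a * p ^ 2 * e * p ^ (2 * j) = a * p * e * p ^ (2 * j + 1) by ring]
        exact sub_ne_zero.mpr (he _).symm
      simp only [hG]
      rw [e1, e2, e3, e4, evenAlpha_succ e ha,
        show p ^ (2 * (j + 1)) = p ^ 2 * p ^ (2 * j) by ring]
      have k0 := hq1 0
      have k1 := hq1 1
      have k2 := hq1 2
      clear_value Y
      clear hG e1 e2 e3 e4 G ih hq1
      generalize evenAlpha a p e j = α at *
      generalize invPoch p (n + 1) (2 * j) = V at *
      generalize qPoch (a * p) p (n + 2 * j) = Q at *
      generalize p ^ (2 * j) = Z at *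
      have c0 : 1 - a * Y * Z * p = 1 - a * p * (Y * Z * p ^ 0) := by ring
      have c1 : 1 - a * Y * (p ^ 2 * Z) = 1 - a * p * (Y * Z * p ^ 1) := by ring
      have c2 : 1 - a * Y * (p ^ 2 * Z) * p = 1 - a * p * (Y * Z * p ^ 2) := by ring
      have c3 : 1 - a * (p ^ 2 * Z) ^ 2 = 1 - a * Z ^ 2 * p ^ 4 := by ring
      have c4 : 1 - a * e * (p ^ 2 * Z) = 1 - a * p ^ 2 * e * Z := by ring
      rw [c0, c1, c2, c3, c4]
      have c5 : 1 - a * p * (Y * Z * p ^ 0) = 1 - a * p * Y * Z := by ring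
      rw [c5] at k0 ⊢
      generalize 1 - a * p * (Y * Z * p ^ 1) = K1 at *
      generalize 1 - a * p * (Y * Z * p ^ 2) = K2 at *
      generalize 1 - a * p ^ 2 * e * Z = H7 at *
      generalize 1 - p ^ 2 * Z = H6 at *
      generalize 1 - a * Z ^ 2 * p ^ 4 = H5 at *
      field_simp
      ring
    have hsum := Finset.sum_congr (rfl : Finset.range J = Finset.range J) fun j _ => hstep j
    rw [← Finset.mul_sum, Finset.sum_add_distrib, ← Finset.mul_sum, Finset.sum_range_sub,
      ih (by omega)] at hsum
    have hG0 : G 0 = 0 := by simp [hG]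
    have hGJ : G J = 0 := by simp [hG, invPoch, hJ]
    rw [hG0, hGJ, sub_self, add_zero, ← quadraticBeta_succ hp ha he] at hsum
    refine mul_left_cancel₀ ?_ hsum
    have h1 : 1 - p * p ^ n ≠ 0 := one_sub_ne_zero_of_norm (norm_mul_pow_lt hp hp.le n)
    have h2 : 1 - a * p * (p ^ n) ^ 2 ≠ 0 := by
      rw [show a * p * (p ^ n) ^ 2 = a * p ^ (2 * n + 1) by ring]
      exact sub_ne_zero.mpr (ha _).symm
    have h3 : 1 - a * p * e * p ^ n ≠ 0 := sub_ne_zero.mpr (he n).symm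
    exact mul_ne_zero (mul_ne_zero h2 h3) h1

/-- The sequence which is `u (n / 2)` at even `n` and zero at odd `n`. -/
noncomputable def evenExtend (u : ℕ → ℂ) (n : ℕ) : ℂ :=
  if Even n then u (n / 2) else 0

theorem evenExtend_two_mul (u : ℕ → ℂ) (n : ℕ) : evenExtend u (2 * n) = u n := by
  simp [evenExtend]

theorem evenExtend_two_mul_add_one (u : ℕ → ℂ) (n : ℕ) : evenExtend u (2 * n + 1) = 0 := by
  simp [evenExtend]

theorem sum_range_two_mul (f : ℕ → ℂ) (n : ℕ) :
    ∑ i ∈ Finset.range (2 * n), f i = ∑ j ∈ Finset.range n, (f (2 * j) + f (2 * j + 1)) := by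
  induction n with
  | zero => simp
  | succ n ih => rw [mul_add, mul_one, Finset.sum_range_succ, Finset.sum_range_succ, ih,
      Finset.sum_range_succ, add_assoc]

theorem isBaileyPair_evenAlpha {a p e : ℂ} (h0 : p ≠ 0) (hp : ‖p‖ < 1)
    (ha : ∀ k : ℕ, a * p ^ k ≠ 1) (he : ∀ k : ℕ, a * p * e * p ^ k ≠ 1) :
    IsBaileyPair a p (evenExtend (evenAlpha a p e)) (quadraticBeta a p e) where
  alpha_zero := by
    simpa using (evenExtend_two_mul (evenAlpha a p e) 0).trans
      (evenAlpha_zero p e (by simpa using ha 0))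
  beta_zero := by simp [quadraticBeta, qPoch]
  beta_eq n _ := by
    rw [← sum_evenAlpha_eq h0 hp ha he n (n + 1) (by omega)]
    set f : ℕ → ℂ := fun i => evenExtend (evenAlpha a p e) i * invPoch p n i *
      (qPoch (a * p) p (n + i))⁻¹ with hf
    have h1 : ∑ i ∈ Finset.range (2 * (n + 1)), f i = ∑ i ∈ Finset.range (n + 1), f i := by
      refine (Finset.sum_subset (Finset.range_mono (by omega)) fun i _ hi => ?_).symm
      simp only [Finset.mem_range, not_lt] at hi
      simp only [hf]
      rw [invPoch, if_neg (by omega), mul_zero, zero_mul]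
    have h2 : ∀ j, evenAlpha a p e j * invPoch p n (2 * j) * (qPoch (a * p) p (n + 2 * j))⁻¹ =
        f (2 * j) + f (2 * j + 1) := fun j => by
      simp only [hf]
      rw [evenExtend_two_mul, evenExtend_two_mul_add_one]
      ring
    rw [Finset.sum_congr rfl fun j _ => h2 j, ← sum_range_two_mul, h1]
    refine Finset.sum_congr rfl fun i hi => ?_
    simp only [hf]
    rw [invPoch, if_pos (Nat.lt_succ_iff.mp (Finset.mem_range.mp hi)), div_eq_mul_inv, mul_inv,
      mul_assoc]

/-! ### Convergence for the even Bailey pair. -/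

theorem SeriesSum.of_even {x : ℕ → ℂ} {A : ℂ} (hodd : ∀ n, x (2 * n + 1) = 0)
    (h : SeriesSum (fun n => x (2 * n)) A) : SeriesSum x A := by
  rw [seriesSum_iff] at h ⊢
  have h1 : ∀ N : ℕ, ∑ i ∈ Finset.range N, x (i + 1) =
      ∑ n ∈ Finset.range (N / 2), x (2 * (n + 1)) := by
    intro N
    induction N with
    | zero => simp
    | succ N ih =>
      rw [Finset.sum_range_succ, ih]
      rcases Nat.even_or_odd' N with ⟨m, rfl | rfl⟩
      · rw [hodd, add_zero, show (2 * m + 1) / 2 = 2 * m / 2 by omega]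
      · rw [show (2 * m + 1 + 1) / 2 = (2 * m + 1) / 2 + 1 by omega, Finset.sum_range_succ,
          show (2 * m + 1) / 2 = m by omega, mul_add]
  simp only [h1]
  exact h.comp (Nat.tendsto_div_const_atTop two_ne_zero)

/-- The term is (K r^n)^n, eventually at most 2^{-n} in absolute value. -/
theorem summable_pow_mul_pow_sq (K : ℝ) {r : ℝ} (hr : 0 ≤ r) (hr1 : r < 1) :
    Summable fun n : ℕ => K ^ n * r ^ (n ^ 2) := by
  refine Summable.of_norm_bounded_eventually_nat
    (summable_geometric_of_lt_one (r := 1 / 2) (by norm_num) (by norm_num)) ?_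
  have h1 : Tendsto (fun n : ℕ => |K| * r ^ n) atTop (𝓝 0) := by
    simpa using (tendsto_pow_atTop_nhds_zero_of_lt_one hr hr1).const_mul |K|
  filter_upwards [h1.eventually_le_const (show (0 : ℝ) < 1 / 2 by norm_num)] with n hn
  rw [norm_mul, norm_pow, norm_pow, Real.norm_eq_abs, Real.norm_eq_abs, abs_of_nonneg hr, sq,
    pow_mul, ← mul_pow]
  gcongr

/-- The Gaussian factor p^{2n²} beats the geometric growth of a^n and of ∏ (e - p^{2i}); all other
factors are bounded. -/
theorem summable_evenAlpha {a p e c : ℂ} (hp : ‖p‖ < 1) (hc : ‖c‖ < 1) :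
    Summable fun n : ℕ => qPoch (p ^ 2) (p ^ 2) (2 * n - 1) * (-c) ^ (2 * n) /
      qPoch (c ^ 2) (p ^ 2) (2 * n) * evenAlpha a p e n := by
  have hp2 := norm_sq_lt hp
  have hc2 : ‖c ^ 2‖ < 1 := norm_pow_succ_lt hc 1
  obtain ⟨C₁, hC₁, h₁⟩ := exists_norm_inv_qPoch_le (c ^ 2) hp2
  obtain ⟨C₂, hC₂, h₂⟩ := exists_norm_inv_qPoch_le (p ^ 2) hp2
  obtain ⟨C₃, hC₃, h₃⟩ := exists_norm_inv_qPoch_le (a * p ^ 2 * e) hp2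
  set D₁ := Real.exp (1 / (1 - ‖p ^ 2‖))
  set D₂ := Real.exp (‖a‖ / (1 - ‖p ^ 2‖))
  have hD₁ : 0 < D₁ := Real.exp_pos _
  have hD₂ : 0 < D₂ := Real.exp_pos _
  set K := (1 + ‖a‖) * ‖(1 - a)⁻¹‖
  refine Summable.of_norm_bounded ((summable_pow_mul_pow_sq (‖a‖ * (‖e‖ + 1)) (norm_nonneg p)
    hp).mul_left (D₁ * C₁ * (K * (D₂ * (C₂ * C₃))))) fun n => ?_
  have b1 := norm_qPoch_le hp2.le hp2 (2 * n - 1)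
  have b2 : ‖(-c) ^ (2 * n)‖ ≤ 1 := by
    rw [norm_pow, norm_neg]
    exact pow_le_one₀ (norm_nonneg c) hc.le
  have b3 : ‖1 - a * p ^ (4 * n)‖ ≤ 1 + ‖a‖ := by
    refine (norm_sub_le _ _).trans ?_
    rw [norm_one]
    gcongr
    exact norm_mul_pow_le hp.le _
  have b4 := norm_qPoch_le (le_refl ‖a‖) hp2 n
  have b5 : ‖∏ i ∈ Finset.range n, (e - (p ^ 2) ^ i)‖ ≤ (‖e‖ + 1) ^ n := by
    rw [norm_prod]
    refine (Finset.prod_le_prod (g := fun _ => ‖e‖ + 1) (fun i _ => norm_nonneg _)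
      fun i _ => (norm_sub_le _ _).trans ?_).trans (by simp)
    gcongr
    rw [norm_pow]
    exact pow_le_one₀ (norm_nonneg _) hp2.le
  have b6 : ‖a ^ n * p ^ (2 * n ^ 2)‖ ≤ ‖a‖ ^ n * ‖p‖ ^ (n ^ 2) := by
    rw [norm_mul, norm_pow, norm_pow]
    gcongr ?_ * ?_
    exact pow_le_pow_of_le_one (norm_nonneg p) hp.le (by omega)
  have b7 := h₁ (2 * n)
  have b8 := h₂ n
  have b9 := h₃ n
  rw [evenAlpha, div_eq_mul_inv (_ * _), div_eq_mul_inv (1 - _), div_eq_mul_inv (qPoch a _ _),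
    mul_inv]
  simp only [norm_mul] at b6 ⊢
  calc _ ≤ D₁ * 1 * C₁ * ((1 + ‖a‖) * ‖(1 - a)⁻¹‖ * (D₂ * (C₂ * C₃)) *
        (‖a‖ ^ n * ‖p‖ ^ (n ^ 2)) * (‖e‖ + 1) ^ n) := by gcongr
    _ = _ := by
      rw [mul_pow]
      ring

theorem exists_seriesSum_evenAlpha {a p c e : ℂ} (h0 : p ≠ 0) (hp : ‖p‖ < 1) (hac : a * p = c)
    (hc : ‖c‖ < 1) (ha : ∀ k : ℕ, a * p ^ k ≠ 1) (he : ∀ k : ℕ, a * p * e * p ^ k ≠ 1) :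
    ∃ A : ℂ, SeriesSum (fun n => qPoch (p ^ 2) (p ^ 2) (2 * n - 1) * (-c) ^ (2 * n) /
        qPoch (c ^ 2) (p ^ 2) (2 * n) * evenAlpha a p e n) A ∧
      SeriesSum (fun n => qPoch (p ^ 2) (p ^ 2) (n - 1) * (-c) ^ n * quadraticBeta a p e n)
        (A + ∑' n, lambertTerm p c n) := by
  obtain ⟨A, hA⟩ : ∃ A : ℂ, SeriesSum (fun n => qPoch (p ^ 2) (p ^ 2) (2 * n - 1) *
      (-c) ^ (2 * n) / qPoch (c ^ 2) (p ^ 2) (2 * n) * evenAlpha a p e n) A :=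
    ⟨_, HasSum.seriesSum ((summable_nat_add_iff 1).mpr
      (summable_evenAlpha (a := a) (e := e) hp hc)).hasSum⟩
  have hA' : SeriesSum (fun n => qPoch (p ^ 2) (p ^ 2) (n - 1) * (-c) ^ n /
      qPoch (c ^ 2) (p ^ 2) n * evenExtend (evenAlpha a p e) n) A := by
    apply SeriesSum.of_even
    · intro n
      rw [evenExtend_two_mul_add_one, mul_zero]
    · simpa only [evenExtend_two_mul] using hA
  exact ⟨A, hA, (isBaileyPair_evenAlpha h0 hp ha he).seriesSum hp hac hc hA'⟩

/-! ### Specialisation to the five expansions. -/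

theorem prod_inv_sub_pow {d : ℂ} (hd : d ≠ 0) (p : ℂ) (n : ℕ) :
    ∏ i ∈ Finset.range n, (1 / d - p ^ i) = qPoch d p n / d ^ n := by
  rw [eq_div_iff (pow_ne_zero n hd), mul_comm, ← prod_range_const_mul, qPoch]
  refine Finset.prod_congr rfl fun i _ => ?_
  field_simp

theorem prod_zero_sub_pow (q : ℂ) (n : ℕ) :
    ∏ i ∈ Finset.range n, (0 - (q ^ 6) ^ i) = (-1) ^ n * q ^ (3 * n ^ 2 - 3 * n) := by
  induction n with
  | zero => simp
  | succ n ih =>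
    have h : 3 * (n + 1) ^ 2 - 3 * (n + 1) = (3 * n ^ 2 - 3 * n) + 6 * n := by
      have : n ≤ n ^ 2 := Nat.le_self_pow two_ne_zero n
      rw [show 3 * (n + 1) ^ 2 = 3 * n ^ 2 + 6 * n + 3 by ring]
      omega
    rw [Finset.prod_range_succ, ih, h, pow_add q, pow_mul q 6]
    ring

theorem qPoch_zero_left (p : ℂ) (n : ℕ) : qPoch 0 p n = 1 := by simp [qPoch]

theorem explicit_expansion_quadratic {q : ℂ} (hq : ‖q‖ < 1) :
    ∃ S T : ℂ,
      SeriesSum (fun n => (1 - q ^ (6 * n - 2)) * qPoch (-q ^ 3) (q ^ 3) (n - 1)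
        * q ^ ((3 * n ^ 2 - n) / 2)
        / ((1 - q ^ (3 * n - 2)) * (1 - q ^ (3 * n)) * qPoch (-q) (q ^ 3) n)) S ∧
      SeriesSum (fun n => (1 - q ^ (6 * n - 1)) * qPoch (-q ^ 3) (q ^ 3) (n - 1)
        * q ^ ((3 * n ^ 2 + n) / 2)
        / ((1 - q ^ (3 * n - 1)) * (1 - q ^ (3 * n)) * qPoch (-q ^ 2) (q ^ 3) n)) T ∧
      q * (ramanujanPsi (q ^ 3) ^ 3 / ramanujanPsi q) = S - T := by
  have hp := norm_cube_lt hq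
  have hq2 : ‖q ^ 2‖ < 1 := norm_sq_lt hq
  refine ⟨∑' n, quadraticLambertTerm (q ^ 3) q n, ∑' n, quadraticLambertTerm (q ^ 3) (q ^ 2) n,
    HasSum.seriesSum ((summable_quadraticLambertTerm hp hq).hasSum.congr_fun ?_),
    HasSum.seriesSum ((summable_quadraticLambertTerm hp hq2).hasSum.congr_fun ?_), ?_⟩
  · intro n
    -- The division is exact because n(n+1) is even, and the subtractions do not truncate because
    -- the index is n+1.
    have e1 : (3 * (n + 1) ^ 2 - (n + 1)) / 2 = (n + 1) + 3 * ((n + 1) * n / 2) := by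
      obtain ⟨m, hm⟩ := Nat.even_mul_succ_self n
      have h1 : (n + 1) * n = 2 * m := by rw [mul_comm]; omega
      have h2 : 3 * (n + 1) ^ 2 = 3 * ((n + 1) * n) + 3 * n + 3 := by ring
      omega
    rw [quadraticLambertTerm, e1, show 6 * (n + 1) - 2 = 6 * n + 4 by omega,
      show 3 * (n + 1) - 2 = 3 * n + 1 by omega, Nat.add_sub_cancel, pow_add q (n + 1),
      pow_mul q 3 (_ / 2), show q * (q ^ 3) ^ (2 * n + 1) = q ^ (6 * n + 4) by ring,
      show q * (q ^ 3) ^ n = q ^ (3 * n + 1) by ring, ← pow_mul q 3 (n + 1)]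
    ring
  · intro n
    have e1 : (3 * (n + 1) ^ 2 + (n + 1)) / 2 = 2 * (n + 1) + 3 * ((n + 1) * n / 2) := by
      obtain ⟨m, hm⟩ := Nat.even_mul_succ_self n
      have h1 : (n + 1) * n = 2 * m := by rw [mul_comm]; omega
      have h2 : 3 * (n + 1) ^ 2 = 3 * ((n + 1) * n) + 3 * n + 3 := by ring
      omega
    rw [quadraticLambertTerm, e1, show 6 * (n + 1) - 1 = 6 * n + 5 by omega,
      show 3 * (n + 1) - 1 = 3 * n + 2 by omega, Nat.add_sub_cancel, pow_add q (2 * (n + 1)),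
      pow_mul q 3 (_ / 2), show q ^ 2 * (q ^ 3) ^ (2 * n + 1) = q ^ (6 * n + 5) by ring,
      show q ^ 2 * (q ^ 3) ^ n = q ^ (3 * n + 2) by ring, ← pow_mul q 3 (n + 1),
      pow_mul q 2 (n + 1)]
    ring
  · rw [tsum_quadraticLambertTerm hp hq, tsum_quadraticLambertTerm hp hq2,
      ← lambertTerm_sub_eq_theta hq]
    ring

theorem explicit_expansion_alternating {q : ℂ} (hq : ‖q‖ < 1) :
    ∃ S T : ℂ,
      SeriesSum (fun n => qPoch (-q ^ 3) (q ^ 3) (n - 1) * (-1) ^ n * q ^ (2 * n)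
        / ((1 - q ^ (3 * n)) * qPoch (q ^ 2) (q ^ 3) n)) S ∧
      SeriesSum (fun n => qPoch (-q ^ 3) (q ^ 3) (n - 1) * (-1) ^ n * q ^ n
        / ((1 - q ^ (3 * n)) * qPoch q (q ^ 3) n)) T ∧
      q * (ramanujanPsi (q ^ 3) ^ 3 / ramanujanPsi q) = S - T := by
  have hp := norm_cube_lt hq
  have hq2 : ‖q ^ 2‖ < 1 := norm_sq_lt hq
  refine ⟨∑' n, lambertTerm (q ^ 3) (q ^ 2) n, ∑' n, lambertTerm (q ^ 3) q n,
    HasSum.seriesSum ((summable_lambertTerm hp hq2).hasSum.congr_fun ?_),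
    HasSum.seriesSum ((summable_lambertTerm hp hq).hasSum.congr_fun ?_),
    (lambertTerm_sub_eq_theta hq).symm⟩
  · intro n
    rw [lambertTerm, Nat.add_sub_cancel, ← pow_mul q 3, neg_pow (q ^ 2), ← pow_mul q 2]
    ring
  · intro n
    rw [lambertTerm, Nat.add_sub_cancel, ← pow_mul q 3, neg_pow q]
    ring

/-- The two instances c = q² and c = q of Bailey's lemma give B₁ - A₂ = L(q²) and B₂ - A₁ = L(q);
subtract. -/
theorem baileyPair_expansion {q : ℂ} (hq : ‖q‖ < 1) (h0 : q ≠ 0) {α₁ β₁ α₂ β₂ : ℕ → ℂ}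
    (h₁ : IsBaileyPair (1 / q) (q ^ 3) α₁ β₁) (h₂ : IsBaileyPair (1 / q ^ 2) (q ^ 3) α₂ β₂)
    {A₁ A₂ : ℂ}
    (hA₁ : SeriesSum (fun n => qPoch (q ^ 6) (q ^ 6) (n - 1) * (-q) ^ n
      / qPoch (q ^ 2) (q ^ 6) n * α₂ n) A₁)
    (hA₂ : SeriesSum (fun n => qPoch (q ^ 6) (q ^ 6) (n - 1) * (-q ^ 2) ^ n
      / qPoch (q ^ 4) (q ^ 6) n * α₁ n) A₂) :
    ∃ B₁ B₂ : ℂ,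
      SeriesSum (fun n => qPoch (q ^ 6) (q ^ 6) (n - 1) * (-q ^ 2) ^ n * β₁ n) B₁ ∧
      SeriesSum (fun n => qPoch (q ^ 6) (q ^ 6) (n - 1) * (-q) ^ n * β₂ n) B₂ ∧
      q * (ramanujanPsi (q ^ 3) ^ 3 / ramanujanPsi q) = B₁ - B₂ + A₁ - A₂ := by
  have hp := norm_cube_lt hq
  have e4 : (q ^ 2) ^ 2 = q ^ 4 := by rw [← pow_mul]
  have t₁ := h₁.seriesSum (c := q ^ 2) (A := A₂) hp (by field_simp) (norm_sq_lt hq)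
    (by rwa [pow_three_sq, e4])
  have t₂ := h₂.seriesSum (c := q) (A := A₁) hp (by field_simp) hq
    (by rwa [pow_three_sq])
  rw [pow_three_sq] at t₁ t₂
  refine ⟨_, _, t₁, t₂, ?_⟩
  rw [← lambertTerm_sub_eq_theta hq]
  ring

/-- The expansion attached to the Bailey pair `evenAlpha`, `quadraticBeta`. -/
theorem evenAlpha_expansion {q : ℂ} (hq : ‖q‖ < 1) (h0 : q ≠ 0) {e : ℂ}
    (he : ∀ n : ℕ, q ^ (3 * n + 1) * e ≠ 1 ∧ q ^ (3 * n + 2) * e ≠ 1) :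
    ∃ S₁ S₂ S₃ S₄ : ℂ,
      SeriesSum (fun n => qPoch (q ^ 6) (q ^ 6) (n - 1) * (-q ^ 2) ^ n *
        quadraticBeta (1 / q) (q ^ 3) e n) S₁ ∧
      SeriesSum (fun n => qPoch (q ^ 6) (q ^ 6) (n - 1) * (-q) ^ n *
        quadraticBeta (1 / q ^ 2) (q ^ 3) e n) S₂ ∧
      SeriesSum (fun n => qPoch (q ^ 6) (q ^ 6) (2 * n - 1) * (-q) ^ (2 * n) /
        qPoch (q ^ 2) (q ^ 6) (2 * n) * evenAlpha (1 / q ^ 2) (q ^ 3) e n) S₃ ∧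
      SeriesSum (fun n => qPoch (q ^ 6) (q ^ 6) (2 * n - 1) * (-q ^ 2) ^ (2 * n) /
        qPoch (q ^ 4) (q ^ 6) (2 * n) * evenAlpha (1 / q) (q ^ 3) e n) S₄ ∧
      q * (ramanujanPsi (q ^ 3) ^ 3 / ramanujanPsi q) = S₁ - S₂ + S₃ - S₄ := by
  have hp := norm_cube_lt hq
  have hp0 : q ^ 3 ≠ 0 := pow_ne_zero 3 h0
  have e4 : (q ^ 2) ^ 2 = q ^ 4 := by rw [← pow_mul]
  have hinj := pow_injective_of_norm h0 hq
  -- The value is q^{3k-b}, whose exponent is never 0 because 3 does not divide b.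
  have ha : ∀ b : ℕ, b = 1 ∨ b = 2 → ∀ k : ℕ, 1 / q ^ b * (q ^ 3) ^ k ≠ 1 := by
    intro b hb k h
    rw [one_div, inv_mul_eq_one₀ (pow_ne_zero b h0), ← pow_mul] at h
    have := hinj h
    omega
  obtain ⟨A₄, hA₄, hB₁⟩ := exists_seriesSum_evenAlpha (a := 1 / q) (c := q ^ 2) (e := e) hp0 hp
    (by field_simp) (norm_sq_lt hq) (by simpa using ha 1 (Or.inl rfl)) (fun k => by
      have := (he k).2
      rwa [show 1 / q * q ^ 3 * e * (q ^ 3) ^ k = q ^ (3 * k + 2) * e by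
        rw [pow_add, pow_mul]; field_simp])
  obtain ⟨A₃, hA₃, hB₂⟩ := exists_seriesSum_evenAlpha (a := 1 / q ^ 2) (c := q) (e := e) hp0 hp
    (by field_simp) hq (ha 2 (Or.inr rfl)) (fun k => by
      have := (he k).1
      rwa [show 1 / q ^ 2 * q ^ 3 * e * (q ^ 3) ^ k = q ^ (3 * k + 1) * e by
        rw [pow_add, pow_mul]; field_simp])
  rw [pow_three_sq] at hA₄ hB₁ hA₃ hB₂
  rw [e4] at hA₄
  refine ⟨_, _, _, _, hB₁, hB₂, hA₃, hA₄, ?_⟩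
  rw [← lambertTerm_sub_eq_theta hq]
  ring

/-- The power `w` is 1 for a = 1/q², c = q, and q^{3n} for a = 1/q, c = q²; this accounts for the
different exponents of the two α-series. -/
theorem mul_evenAlpha_eq {q a c w : ℂ} (e D δ : ℂ) {n : ℕ} (hw : (-c) ^ (2 * n) * a ^ n = w) :
    δ * (-c) ^ (2 * n) / D * evenAlpha a (q ^ 3) e n =
      (1 - a * q ^ (12 * n)) * δ * qPoch a (q ^ 6) n * (w * q ^ (6 * n ^ 2)) *
        (∏ i ∈ Finset.range n, (e - (q ^ 6) ^ i)) /
        ((1 - a) * D * (qPoch (a * q ^ 6 * e) (q ^ 6) n * qPoch (q ^ 6) (q ^ 6) n)) := by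
  rw [evenAlpha, pow_three_sq, ← pow_mul, ← pow_mul, ← hw, show 3 * (4 * n) = 12 * n by ring,
    show 3 * (2 * n ^ 2) = 6 * n ^ 2 by ring]
  generalize 1 - a = K
  generalize 1 - a * q ^ (12 * n) = L
  generalize (-c) ^ (2 * n) = M
  ring

theorem parametric_expansion {q : ℂ} (hq : ‖q‖ < 1) (h0 : q ≠ 0) {d : ℂ} (hd : d ≠ 0)
    (hdq : ∀ n : ℕ, d ≠ q ^ (3 * n + 1) ∧ d ≠ q ^ (3 * n + 2)) :
    ∃ S₁ S₂ S₃ S₄ : ℂ,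
      SeriesSum (fun n => qPoch (q ^ 6) (q ^ 6) (n - 1) * qPoch (q ^ 2 / d) (q ^ 6) n
        * (-q ^ 2) ^ n
        / (qPoch (q ^ 2) (q ^ 6) n
          * (qPoch (q ^ 2 / d) (q ^ 3) n * qPoch (q ^ 3) (q ^ 3) n))) S₁ ∧
      SeriesSum (fun n => qPoch (q ^ 6) (q ^ 6) (n - 1) * qPoch (q / d) (q ^ 6) n
        * (-q) ^ n
        / (qPoch q (q ^ 6) n
          * (qPoch (q / d) (q ^ 3) n * qPoch (q ^ 3) (q ^ 3) n))) S₂ ∧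
      SeriesSum (fun n => (1 - q ^ (12 * n - 2)) * qPoch (q ^ 6) (q ^ 6) (2 * n - 1)
        * (qPoch (1 / q ^ 2) (q ^ 6) n * qPoch d (q ^ 6) n) * q ^ (6 * n ^ 2)
        / ((1 - 1 / q ^ 2) * qPoch (q ^ 2) (q ^ 6) (2 * n)
          * (qPoch (q ^ 4 / d) (q ^ 6) n * qPoch (q ^ 6) (q ^ 6) n) * d ^ n)) S₃ ∧
      SeriesSum (fun n => (1 - q ^ (12 * n - 1)) * qPoch (q ^ 6) (q ^ 6) (2 * n - 1)
        * (qPoch (1 / q) (q ^ 6) n * qPoch d (q ^ 6) n) * q ^ (6 * n ^ 2 + 3 * n)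
        / ((1 - 1 / q) * qPoch (q ^ 4) (q ^ 6) (2 * n)
          * (qPoch (q ^ 5 / d) (q ^ 6) n * qPoch (q ^ 6) (q ^ 6) n) * d ^ n)) S₄ ∧
      q * (ramanujanPsi (q ^ 3) ^ 3 / ramanujanPsi q) = S₁ - S₂ + S₃ - S₄ := by
  obtain ⟨S₁, S₂, S₃, S₄, h₁, h₂, h₃, h₄, h⟩ := evenAlpha_expansion hq h0 (e := 1 / d) fun n => by
    simp only [mul_one_div, ne_eq, div_eq_one_iff_eq hd]
    exact ⟨(hdq n).1.symm, (hdq n).2.symm⟩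
  refine ⟨S₁, S₂, S₃, S₄, h₁.congr fun n => ?_, h₂.congr fun n => ?_, h₃.congr fun n => ?_,
    h₄.congr fun n => ?_, h⟩
  · rw [quadraticBeta, pow_three_sq, show 1 / q * q ^ 3 = q ^ 2 by field_simp, mul_one_div]
    ring
  · rw [quadraticBeta, pow_three_sq, show 1 / q ^ 2 * q ^ 3 = q by field_simp, mul_one_div]
    ring
  · have e1 : 1 / q ^ 2 * q ^ (12 * (n + 1)) = q ^ (12 * (n + 1) - 2) := by
      rw [show 12 * (n + 1) = 12 * (n + 1) - 2 + 2 by omega, pow_add, Nat.add_sub_cancel]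
      field_simp
    have e2 : (-q) ^ (2 * (n + 1)) * (1 / q ^ 2) ^ (n + 1) = 1 := by
      rw [pow_mul, ← mul_pow, neg_sq, mul_one_div_cancel (pow_ne_zero 2 h0), one_pow]
    rw [mul_evenAlpha_eq _ _ _ e2, e1, show 1 / q ^ 2 * q ^ 6 = q ^ 4 by field_simp, mul_one_div,
      prod_inv_sub_pow hd]
    generalize 1 - 1 / q ^ 2 = K
    ring
  · have e1 : 1 / q * q ^ (12 * (n + 1)) = q ^ (12 * (n + 1) - 1) := by
      rw [show 12 * (n + 1) = 12 * (n + 1) - 1 + 1 by omega, pow_succ, Nat.add_sub_cancel]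
      field_simp
    have e2 : (-q ^ 2) ^ (2 * (n + 1)) * (1 / q) ^ (n + 1) = q ^ (3 * (n + 1)) := by
      rw [pow_mul, ← mul_pow, pow_mul]
      congr 1
      field_simp
    rw [mul_evenAlpha_eq _ _ _ e2, e1, show 1 / q * q ^ 6 = q ^ 5 by field_simp, mul_one_div,
      prod_inv_sub_pow hd, pow_add q (6 * (n + 1) ^ 2)]
    generalize 1 - 1 / q = K
    ring

theorem limiting_expansion {q : ℂ} (hq : ‖q‖ < 1) (h0 : q ≠ 0) :
    ∃ S₁ S₂ S₃ S₄ : ℂ,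
      SeriesSum (fun n => qPoch (q ^ 6) (q ^ 6) (n - 1) * (-q ^ 2) ^ n
        / (qPoch (q ^ 2) (q ^ 6) n * qPoch (q ^ 3) (q ^ 3) n)) S₁ ∧
      SeriesSum (fun n => qPoch (q ^ 6) (q ^ 6) (n - 1) * (-q) ^ n
        / (qPoch q (q ^ 6) n * qPoch (q ^ 3) (q ^ 3) n)) S₂ ∧
      SeriesSum (fun n => (1 - q ^ (12 * n - 2)) * qPoch (q ^ 6) (q ^ 6) (2 * n - 1)
        * qPoch (1 / q ^ 2) (q ^ 6) n * (-1) ^ n * q ^ (9 * n ^ 2 - 3 * n)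
        / ((1 - 1 / q ^ 2) * qPoch (q ^ 2) (q ^ 6) (2 * n) * qPoch (q ^ 6) (q ^ 6) n)) S₃ ∧
      SeriesSum (fun n => (1 - q ^ (12 * n - 1)) * qPoch (q ^ 6) (q ^ 6) (2 * n - 1)
        * qPoch (1 / q) (q ^ 6) n * (-1) ^ n * q ^ (9 * n ^ 2)
        / ((1 - 1 / q) * qPoch (q ^ 4) (q ^ 6) (2 * n) * qPoch (q ^ 6) (q ^ 6) n)) S₄ ∧
      q * (ramanujanPsi (q ^ 3) ^ 3 / ramanujanPsi q) = S₁ - S₂ + S₃ - S₄ := by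
  obtain ⟨S₁, S₂, S₃, S₄, h₁, h₂, h₃, h₄, h⟩ := evenAlpha_expansion hq h0 (e := 0) fun n => by
    simp
  have hle : ∀ n : ℕ, 3 * n ≤ 3 * n ^ 2 := fun n =>
    Nat.mul_le_mul_left 3 (Nat.le_self_pow two_ne_zero n)
  refine ⟨S₁, S₂, S₃, S₄, h₁.congr fun n => ?_, h₂.congr fun n => ?_, h₃.congr fun n => ?_,
    h₄.congr fun n => ?_, h⟩
  · rw [quadraticBeta, pow_three_sq, show 1 / q * q ^ 3 = q ^ 2 by field_simp, mul_zero,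
      qPoch_zero_left, qPoch_zero_left]
    ring
  · rw [quadraticBeta, pow_three_sq, show 1 / q ^ 2 * q ^ 3 = q by field_simp, mul_zero,
      qPoch_zero_left, qPoch_zero_left]
    ring
  · have e1 : 1 / q ^ 2 * q ^ (12 * (n + 1)) = q ^ (12 * (n + 1) - 2) := by
      rw [show 12 * (n + 1) = 12 * (n + 1) - 2 + 2 by omega, pow_add, Nat.add_sub_cancel]
      field_simp
    have e2 : (-q) ^ (2 * (n + 1)) * (1 / q ^ 2) ^ (n + 1) = 1 := by
      rw [pow_mul, ← mul_pow, neg_sq, mul_one_div_cancel (pow_ne_zero 2 h0), one_pow]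
    have e3 : 9 * (n + 1) ^ 2 - 3 * (n + 1) = 6 * (n + 1) ^ 2 + (3 * (n + 1) ^ 2 - 3 * (n + 1)) := by
      have := hle (n + 1)
      omega
    rw [mul_evenAlpha_eq _ _ _ e2, e1, mul_zero, qPoch_zero_left, prod_zero_sub_pow, e3,
      pow_add q (6 * _)]
    generalize 1 - 1 / q ^ 2 = K
    ring
  · have e1 : 1 / q * q ^ (12 * (n + 1)) = q ^ (12 * (n + 1) - 1) := by
      rw [show 12 * (n + 1) = 12 * (n + 1) - 1 + 1 by omega, pow_succ, Nat.add_sub_cancel]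
      field_simp
    have e2 : (-q ^ 2) ^ (2 * (n + 1)) * (1 / q) ^ (n + 1) = q ^ (3 * (n + 1)) := by
      rw [pow_mul, ← mul_pow, pow_mul]
      congr 1
      field_simp
    have e3 : 9 * (n + 1) ^ 2 =
        6 * (n + 1) ^ 2 + 3 * (n + 1) + (3 * (n + 1) ^ 2 - 3 * (n + 1)) := by
      have := hle (n + 1)
      omega
    rw [mul_evenAlpha_eq _ _ _ e2, e1, mul_zero, qPoch_zero_left, prod_zero_sub_pow, e3,
      pow_add q (_ + _), pow_add q (6 * _)]
    generalize 1 - 1 / q = K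
    ring

theorem mainTheorem11 (q : ℂ) (hq : ‖q‖ < 1) :
    -- the two explicit `q`-series
    (∃ S T : ℂ,
      SeriesSum (fun n => (1 - q ^ (6 * n - 2)) * qPoch (-q ^ 3) (q ^ 3) (n - 1)
        * q ^ ((3 * n ^ 2 - n) / 2)
        / ((1 - q ^ (3 * n - 2)) * (1 - q ^ (3 * n)) * qPoch (-q) (q ^ 3) n)) S ∧
      SeriesSum (fun n => (1 - q ^ (6 * n - 1)) * qPoch (-q ^ 3) (q ^ 3) (n - 1)
        * q ^ ((3 * n ^ 2 + n) / 2)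
        / ((1 - q ^ (3 * n - 1)) * (1 - q ^ (3 * n)) * qPoch (-q ^ 2) (q ^ 3) n)) T ∧
      q * (ramanujanPsi (q ^ 3) ^ 3 / ramanujanPsi q) = S - T) ∧
    (∃ S T : ℂ,
      SeriesSum (fun n => qPoch (-q ^ 3) (q ^ 3) (n - 1) * (-1) ^ n * q ^ (2 * n)
        / ((1 - q ^ (3 * n)) * qPoch (q ^ 2) (q ^ 3) n)) S ∧
      SeriesSum (fun n => qPoch (-q ^ 3) (q ^ 3) (n - 1) * (-1) ^ n * q ^ n
        / ((1 - q ^ (3 * n)) * qPoch q (q ^ 3) n)) T ∧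
      q * (ramanujanPsi (q ^ 3) ^ 3 / ramanujanPsi q) = S - T) ∧
    -- the expansion in terms of an arbitrary Bailey pair `(α_n(a, Q), β_n(a, Q))`
    (q ≠ 0 → ∀ α β : ℂ → ℂ → ℕ → ℂ,
      IsBaileyPair (1 / q) (q ^ 3) (α (1 / q) (q ^ 3)) (β (1 / q) (q ^ 3)) →
      IsBaileyPair (1 / q ^ 2) (q ^ 3) (α (1 / q ^ 2) (q ^ 3)) (β (1 / q ^ 2) (q ^ 3)) →
      ∀ A₁ A₂ : ℂ,
        SeriesSum (fun n => qPoch (q ^ 6) (q ^ 6) (n - 1) * (-q) ^ n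
          / qPoch (q ^ 2) (q ^ 6) n * α (1 / q ^ 2) (q ^ 3) n) A₁ →
        SeriesSum (fun n => qPoch (q ^ 6) (q ^ 6) (n - 1) * (-q ^ 2) ^ n
          / qPoch (q ^ 4) (q ^ 6) n * α (1 / q) (q ^ 3) n) A₂ →
        ∃ B₁ B₂ : ℂ,
          SeriesSum (fun n => qPoch (q ^ 6) (q ^ 6) (n - 1) * (-q ^ 2) ^ n
            * β (1 / q) (q ^ 3) n) B₁ ∧
          SeriesSum (fun n => qPoch (q ^ 6) (q ^ 6) (n - 1) * (-q) ^ n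
            * β (1 / q ^ 2) (q ^ 3) n) B₂ ∧
          q * (ramanujanPsi (q ^ 3) ^ 3 / ramanujanPsi q) = B₁ - B₂ + A₁ - A₂) ∧
    -- the expansion with a free parameter `d`
    (q ≠ 0 → ∀ d : ℂ, d ≠ 0 → (∀ n : ℕ, d ≠ q ^ (3 * n + 1) ∧ d ≠ q ^ (3 * n + 2)) →
      ∃ S₁ S₂ S₃ S₄ : ℂ,
        SeriesSum (fun n => qPoch (q ^ 6) (q ^ 6) (n - 1) * qPoch (q ^ 2 / d) (q ^ 6) n
          * (-q ^ 2) ^ n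
          / (qPoch (q ^ 2) (q ^ 6) n
            * (qPoch (q ^ 2 / d) (q ^ 3) n * qPoch (q ^ 3) (q ^ 3) n))) S₁ ∧
        SeriesSum (fun n => qPoch (q ^ 6) (q ^ 6) (n - 1) * qPoch (q / d) (q ^ 6) n
          * (-q) ^ n
          / (qPoch q (q ^ 6) n
            * (qPoch (q / d) (q ^ 3) n * qPoch (q ^ 3) (q ^ 3) n))) S₂ ∧
        SeriesSum (fun n => (1 - q ^ (12 * n - 2)) * qPoch (q ^ 6) (q ^ 6) (2 * n - 1)
          * (qPoch (1 / q ^ 2) (q ^ 6) n * qPoch d (q ^ 6) n) * q ^ (6 * n ^ 2)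
          / ((1 - 1 / q ^ 2) * qPoch (q ^ 2) (q ^ 6) (2 * n)
            * (qPoch (q ^ 4 / d) (q ^ 6) n * qPoch (q ^ 6) (q ^ 6) n) * d ^ n)) S₃ ∧
        SeriesSum (fun n => (1 - q ^ (12 * n - 1)) * qPoch (q ^ 6) (q ^ 6) (2 * n - 1)
          * (qPoch (1 / q) (q ^ 6) n * qPoch d (q ^ 6) n) * q ^ (6 * n ^ 2 + 3 * n)
          / ((1 - 1 / q) * qPoch (q ^ 4) (q ^ 6) (2 * n)
            * (qPoch (q ^ 5 / d) (q ^ 6) n * qPoch (q ^ 6) (q ^ 6) n) * d ^ n)) S₄ ∧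
        q * (ramanujanPsi (q ^ 3) ^ 3 / ramanujanPsi q) = S₁ - S₂ + S₃ - S₄) ∧
    -- its limiting form as `d → ∞`
    (q ≠ 0 →
      ∃ S₁ S₂ S₃ S₄ : ℂ,
        SeriesSum (fun n => qPoch (q ^ 6) (q ^ 6) (n - 1) * (-q ^ 2) ^ n
          / (qPoch (q ^ 2) (q ^ 6) n * qPoch (q ^ 3) (q ^ 3) n)) S₁ ∧
        SeriesSum (fun n => qPoch (q ^ 6) (q ^ 6) (n - 1) * (-q) ^ n
          / (qPoch q (q ^ 6) n * qPoch (q ^ 3) (q ^ 3) n)) S₂ ∧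
        SeriesSum (fun n => (1 - q ^ (12 * n - 2)) * qPoch (q ^ 6) (q ^ 6) (2 * n - 1)
          * qPoch (1 / q ^ 2) (q ^ 6) n * (-1) ^ n * q ^ (9 * n ^ 2 - 3 * n)
          / ((1 - 1 / q ^ 2) * qPoch (q ^ 2) (q ^ 6) (2 * n) * qPoch (q ^ 6) (q ^ 6) n)) S₃ ∧
        SeriesSum (fun n => (1 - q ^ (12 * n - 1)) * qPoch (q ^ 6) (q ^ 6) (2 * n - 1)
          * qPoch (1 / q) (q ^ 6) n * (-1) ^ n * q ^ (9 * n ^ 2)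
          / ((1 - 1 / q) * qPoch (q ^ 4) (q ^ 6) (2 * n) * qPoch (q ^ 6) (q ^ 6) n)) S₄ ∧
        q * (ramanujanPsi (q ^ 3) ^ 3 / ramanujanPsi q) = S₁ - S₂ + S₃ - S₄) := 
  ⟨explicit_expansion_quadratic hq, explicit_expansion_alternating hq,
    fun h0 _ _ h₁ h₂ _ _ hA₁ hA₂ => baileyPair_expansion hq h0 h₁ h₂ hA₁ hA₂,
    fun h0 _ hd hdq => parametric_expansion hq h0 hd hdq, fun h0 => limiting_expansion hq h0⟩
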